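/- Let $M$ be an $m$-dimensional smooth manifold (Hausdorff, second countable) and $\mathbf{T}M=TM\oplus T^*M$, with the neutral metric $g((X,\alpha),(Y,\mu))=\alpha(Y)+\mu(X)$ and the Courant bracket $[(X,\alpha),(Y,\mu)]=([X,Y],L_X\mu-L_Y\alpha+\frac12 d(\alpha(Y)-\mu(X)))$. Let $\tau\in End(\mathbf{T}M)$ be a generalized 2-nilpotent structure, i.e. a smooth endomorphism of constant rank with $\tau^2=0$ and $g(\mathcal X,\tau\mathcal Y)+g(\tau\mathcal X,\mathcal Y)=0$. Put $E=\mathrm{im}\,\tau$; then $E^{\perp_g}=\ker\tau$, and $\mathcal X\mapsto g(\mathcal X,\cdot)|_E$ identifies $\mathbf{T}M/E^{\perp_g}$ with the dual bundle $E^*$. Let $\sharp_\Lambda:E^*\to E$ be the isomorphism $[\mathcal X]\mapsto\tau\mathcal X$ and $\Lambda\in\Gamma\wedge^2E$ the bivector field $\Lambda(\alpha,\beta)=\beta(\sharp_\Lambda\alpha)$, i.e. $\Lambda([\mathcal X],[\mathcal Y])=g(\tau\mathcal X,\mathcal Y)$. Assume that $\tau$ is weakly integrable, i.e. $\Gamma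 E$ is closed under the Courant bracket, so that $E$ with the Courant bracket $[\,,]_E$ and the anchor $\rho=pr_{TM}$ is a Lie algebroid, with differential $d_E$ and Lie derivative $L$. On $\Gamma E^*$ consider the Gelfand–Dorfman bracket $$\{\alpha,\beta\}_\Lambda=L_{\sharp_\Lambda\alpha}\beta-L_{\sharp_\Lambda\beta}\alpha-d_E(\Lambda(\alpha,\beta)).$$ Call $\tau$ integrable if $[\tau\mathcal X,\tau\mathcal Y]-\tau[\mathcal X,\tau\mathcal Y]-\tau[\tau\mathcal X,\mathcal Y]+\tau^2[\mathcal X,\mathcal Y]=0$ for all $\mathcal X,\mathcal Y\in\Gamma\mathbf{T}M$. Then the following hold. (1) $\tau$ is integrable if and only if $(E^*,\{\,,\}_\Lambda,\sharp_\Lambda)$ is a Lie algebroid with anchor $\sharp_\Lambda:E^*\to E$ over the Lie algebroid $E$; that is, $\{\,,\}_\Lambda$ and the composed anchor $\rho\circ\sharp_\Lambda:E^*\to TM$ satisfy the axioms of a Lie algebroid on $M$, and $\sharp_\Lambda\{\alpha,\beta\}_\Lambda=[\sharp_\Lambda\alpha,\sharp_\Lambda\beta]_E$ for all $\alpha,\beta\in\Gamma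 E^*$. (2) $\tau$ is integrable if and only if $(E,E^*)$, with the above brackets and with the anchors $\rho$, $\rho\circ\sharp_\Lambda$, is a triangular Lie bialgebroid; that is, $E$ and $E^*$ are Lie algebroids, $d_*[e,e']=[d_*e,e']+[e,d_*e']$ for all $e,e'\in\Gamma E$, where $d_*$ is the differential of $E^*$ and the brackets are Schouten brackets of $E$, and $[\Lambda,\Lambda]=0$. -/

import Mathlib

open scoped Manifold ContDiff Bundle

noncomputable section

namespace GenGeom

/-! ### Linear algebra -/

/-- The linear map `D → W` induced by `q : V → W`, when `p : V → D` is onto and `q` vanishes on the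
kernel of `p`: it maps `p v` to `q v`. -/
def descend {V D W : Type*} [AddCommGroup V] [Module ℝ V] [AddCommGroup D] [Module ℝ D]
    [AddCommGroup W] [Module ℝ W] (p : V →ₗ[ℝ] D) (hp : Function.Surjective p) (q : V →ₗ[ℝ] W)
    (h : ∀ v, p v = 0 → q v = 0) : D →ₗ[ℝ] W :=
  ((LinearMap.ker p).liftQ q h) ∘ₗ (p.quotKerEquivOfSurjective hp).symm.toLinearMap

theorem descend_apply {V D W : Type*} [AddCommGroup V] [Module ℝ V] [AddCommGroup D] [Module ℝ D]
    [AddCommGroup W] [Module ℝ W] (p : V →ₗ[ℝ] D) (hp : Function.Surjective p) (q : V →ₗ[ℝ] W)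
    (h : ∀ v, p v = 0 → q v = 0) (v : V) : descend p hp q h (p v) = q v := by
  have h1 : (p.quotKerEquivOfSurjective hp).symm (p v) = Submodule.Quotient.mk v := by
    rw [LinearEquiv.symm_apply_eq]
    rfl
  rw [descend, LinearMap.comp_apply, LinearEquiv.coe_coe, h1]
  rfl

theorem restrict_surjective {V : Type*} [AddCommGroup V] [Module ℝ V] (U : Submodule ℝ V)
    (B : V →ₗ[ℝ] Module.Dual ℝ V) (hB : Function.Surjective B) :
    Function.Surjective (U.subtype.dualMap ∘ₗ B) :=
  (LinearMap.dualMap_surjective_of_injective U.injective_subtype).comp hB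

variable {m : ℕ} {M : Type*} [TopologicalSpace M] [ChartedSpace (EuclideanSpace ℝ (Fin m)) M]

/-! ### The big tangent bundle and the Courant bracket -/

/-- The cotangent space at `x`. -/
abbrev Cotangent (m : ℕ) {M : Type*} [TopologicalSpace M]
    [ChartedSpace (EuclideanSpace ℝ (Fin m)) M] (x : M) : Type :=
  TangentSpace (𝓡 m) x →L[ℝ] ℝ

/-- The fibre `T_xM ⊕ T_x^*M` of the big tangent bundle. -/
abbrev BigTangent (m : ℕ) {M : Type*} [TopologicalSpace M]
    [ChartedSpace (EuclideanSpace ℝ (Fin m)) M] (x : M) : Type :=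
  TangentSpace (𝓡 m) x × Cotangent m x

instance (x : M) : FiniteDimensional ℝ (TangentSpace (𝓡 m) x) :=
  inferInstanceAs (FiniteDimensional ℝ (EuclideanSpace ℝ (Fin m)))

instance (x : M) : T2Space (TangentSpace (𝓡 m) x) :=
  inferInstanceAs (T2Space (EuclideanSpace ℝ (Fin m)))

/-- The derivative `X(f) = df(X)` of a function along a vector field. -/
def dirDeriv (X : ∀ x : M, TangentSpace (𝓡 m) x) (f : M → ℝ) (x : M) : ℝ :=
  mvfderiv (𝓡 m) f x (X x)

/-- Smooth functions on `M`. -/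
def IsSmoothFun (m : ℕ) {M : Type*} [TopologicalSpace M]
    [ChartedSpace (EuclideanSpace ℝ (Fin m)) M] (f : M → ℝ) : Prop :=
  ContMDiff (𝓡 m) 𝓘(ℝ, ℝ) ∞ f

/-- The neutral metric `g((X, α), (Y, μ)) = α(Y) + μ(X)`. -/
def g (x : M) : BigTangent m x →ₗ[ℝ] BigTangent m x →ₗ[ℝ] ℝ :=
  LinearMap.mk₂ ℝ (fun v w => v.2 w.1 + w.2 v.1)
    (fun _ _ _ => by simp; ring) (fun _ _ _ => by simp; ring)
    (fun _ _ _ => by simp; ring) (fun _ _ _ => by simp; ring)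

theorem g_apply (x : M) (v w : BigTangent m x) : g x v w = v.2 w.1 + w.2 v.1 := rfl

theorem g_injective (x : M) : Function.Injective (g (m := m) x) := by
  rw [injective_iff_map_eq_zero]
  rintro ⟨X, α⟩ h
  have hα : α = 0 := by
    ext Y
    simpa [g_apply] using LinearMap.congr_fun h (Y, 0)
  have hX : X = 0 := by
    rw [← Module.forall_dual_apply_eq_zero_iff ℝ X]
    intro φ
    simpa [g_apply] using LinearMap.congr_fun h (0, LinearMap.toContinuousLinearMap φ)
  rw [hα, hX]
  rfl

theorem g_surjective (x : M) : Function.Surjective (g (m := m) x) :=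
  (LinearMap.injective_iff_surjective_of_finrank_eq_finrank
    (Subspace.dual_finrank_eq (K := ℝ) (V := BigTangent m x)).symm).1 (g_injective x)

variable [IsManifold (𝓡 m) ∞ M]

/-- Smooth vector fields on `M`. -/
def IsSmoothVectorField (X : ∀ x : M, TangentSpace (𝓡 m) x) : Prop :=
  ContMDiff (𝓡 m) (𝓡 m).tangent ∞ (fun x => (⟨x, X x⟩ : TangentBundle (𝓡 m) M))

/-- Smooth `1`-forms on `M`, i.e. smooth sections of the bundle `Hom(TM, ℝ)`. -/
def IsSmoothOneForm (α : ∀ x : M, Cotangent m x) : Prop :=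
  ContMDiff (𝓡 m) ((𝓡 m).prod 𝓘(ℝ, EuclideanSpace ℝ (Fin m) →L[ℝ] ℝ)) ∞
    (fun x => Bundle.TotalSpace.mk' (EuclideanSpace ℝ (Fin m) →L[ℝ] ℝ)
      (E := fun x : M => TangentSpace (𝓡 m) x →L[ℝ] Bundle.Trivial M ℝ x) x (α x))

/-- Smooth sections of the big tangent bundle `TM ⊕ T*M`. -/
def IsSmoothSection (s : ∀ x : M, BigTangent m x) : Prop :=
  IsSmoothVectorField (fun x => (s x).1) ∧ IsSmoothOneForm (fun x => (s x).2)

/-- The value at `x` and on `Z` of the Lie derivative `L_X μ` of a `1`-form: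
`(L_X μ)(Z) = X(μ(Z)) - μ([X, Z])`. -/
def lieFormOn (X : ∀ x : M, TangentSpace (𝓡 m) x) (μ : ∀ x : M, Cotangent m x) (x : M)
    (Z : ∀ x : M, TangentSpace (𝓡 m) x) : ℝ :=
  dirDeriv X (fun y => μ y (Z y)) x - μ x (VectorField.mlieBracket (𝓡 m) X Z x)

/-- The expression `X(μ(Z)) - μ([X, Z])` is tensorial in `Z`, so that it defines a `1`-form. -/
theorem tensorialAt_lieFormOn {X : ∀ x : M, TangentSpace (𝓡 m) x}
    {μ : ∀ x : M, Cotangent m x} (hμ : IsSmoothOneForm μ) (x : M) :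
    TensorialAt (𝓡 m) (EuclideanSpace ℝ (Fin m)) (lieFormOn X μ x) x := by
  have key : ∀ {σ : ∀ x : M, TangentSpace (𝓡 m) x},
      MDifferentiableAt (𝓡 m) (𝓡 m).tangent (fun y => (⟨y, σ y⟩ : TangentBundle (𝓡 m) M)) x →
      MDifferentiableAt (𝓡 m) 𝓘(ℝ, ℝ) (fun y => μ y (σ y)) x := by
    intro σ hσ
    have h := MDifferentiableAt.clm_bundle_apply (E₂ := fun y : M => Bundle.Trivial M ℝ y)
      (F₂ := ℝ) ((hμ x).mdifferentiableAt (by simp)) hσ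
    rw [mdifferentiableAt_section] at h
    exact h
  constructor
  · intro f σ hf hσ
    have h1 := key hσ
    have h2 : (fun y => μ y ((f • σ) y)) = f * (fun y => μ y (σ y)) := by
      funext y
      simp
    simp only [lieFormOn, dirDeriv]
    rw [VectorField.mlieBracket_smul_right hf hσ, h2, mvfderiv_mul hf h1]
    simp
    ring
  · intro σ σ' hσ hσ'
    have h1 := key hσ
    have h2 := key hσ'
    have h3 : (fun y => μ y ((σ + σ') y)) = (fun y => μ y (σ y)) + (fun y => μ y (σ' y)) := by
      funext y
      simp
    simp only [lieFormOn, dirDeriv]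
    rw [VectorField.mlieBracket_add_right hσ hσ', h3, mvfderiv_add h1 h2]
    simp
    ring

/-- The Lie derivative `L_X μ` of a `1`-form along a vector field. By `tensorialAt_lieFormOn`, the
dummy value `0` is never taken when `μ` is smooth. -/
def lieForm (X : ∀ x : M, TangentSpace (𝓡 m) x) (μ : ∀ x : M, Cotangent m x) (x : M) :
    Cotangent m x :=
  open Classical in
  if h : TensorialAt (𝓡 m) (EuclideanSpace ℝ (Fin m)) (lieFormOn X μ x) x then
    TensorialAt.mkHom _ x h
  else 0

/-- `(L_X μ)(Z) = X(μ(Z)) - μ([X, Z])`. -/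
theorem lieForm_apply {X : ∀ x : M, TangentSpace (𝓡 m) x} {μ : ∀ x : M, Cotangent m x}
    (hμ : IsSmoothOneForm μ) {Z : ∀ x : M, TangentSpace (𝓡 m) x} (hZ : IsSmoothVectorField Z)
    (x : M) :
    lieForm X μ x (Z x) =
      dirDeriv X (fun y => μ y (Z y)) x - μ x (VectorField.mlieBracket (𝓡 m) X Z x) := by
  rw [lieForm, dif_pos (tensorialAt_lieFormOn hμ x),
    TensorialAt.mkHom_apply _ ((hZ x).mdifferentiableAt (by simp))]
  rfl

/-- The Courant bracket
`[(X, α), (Y, μ)] = ([X, Y], L_X μ - L_Y α + (1/2) d(α(Y) - μ(X)))`. -/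
def courant (s t : ∀ x : M, BigTangent m x) (x : M) : BigTangent m x :=
  (VectorField.mlieBracket (𝓡 m) (fun y => (s y).1) (fun y => (t y).1) x,
    lieForm (fun y => (s y).1) (fun y => (t y).2) x
      - lieForm (fun y => (t y).1) (fun y => (s y).2) x
      + (1 / 2 : ℝ) • mvfderiv (𝓡 m) (fun y => (s y).2 (t y).1 - (t y).2 (s y).1) x)

/-! ### Lie algebroids -/

/-- The axioms of a Lie algebroid over `M` for a vector bundle with fibres `V x` and set `Γ` of
smooth sections, a bracket of sections and an anchor `ρ : V → TM`. -/
structure IsLieAlgebroid {V : M → Type*} [∀ x, AddCommGroup (V x)] [∀ x, Module ℝ (V x)]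
    (Γ : Set (∀ x, V x)) (bracket : (∀ x, V x) → (∀ x, V x) → ∀ x, V x)
    (ρ : ∀ x, V x →ₗ[ℝ] TangentSpace (𝓡 m) x) : Prop where
  bracket_mem : ∀ a ∈ Γ, ∀ b ∈ Γ, bracket a b ∈ Γ
  anchor_smooth : ∀ a ∈ Γ, IsSmoothVectorField (fun x => ρ x (a x))
  add_left : ∀ a ∈ Γ, ∀ b ∈ Γ, ∀ c ∈ Γ, bracket (a + b) c = bracket a c + bracket b c
  smul_left : ∀ r : ℝ, ∀ a ∈ Γ, ∀ b ∈ Γ, bracket (r • a) b = r • bracket a b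
  skew : ∀ a ∈ Γ, ∀ b ∈ Γ, bracket a b = -bracket b a
  jacobi : ∀ a ∈ Γ, ∀ b ∈ Γ, ∀ c ∈ Γ,
    bracket (bracket a b) c + bracket (bracket b c) a + bracket (bracket c a) b = 0
  leibniz : ∀ f : M → ℝ, IsSmoothFun m f → ∀ a ∈ Γ, ∀ b ∈ Γ, ∀ x,
    bracket a (fun y => f y • b y) x =
      f x • bracket a b x + dirDeriv (fun y => ρ y (a y)) f x • b x
  anchor_bracket : ∀ a ∈ Γ, ∀ b ∈ Γ, ∀ x,
    ρ x (bracket a b x) =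
      VectorField.mlieBracket (𝓡 m) (fun y => ρ y (a y)) (fun y => ρ y (b y)) x

/-! ### Generalized 2-nilpotent structures -/

/-- A generalized 2-nilpotent structure: a smooth endomorphism `τ` of `TM ⊕ T*M`, of constant rank,
with `τ² = 0` and `g(v, τ w) + g(τ v, w) = 0`. (A family of linear maps of the fibres is smooth if
and only if it maps smooth sections to smooth sections.) -/
structure TwoNilpotent (m : ℕ) (M : Type*) [TopologicalSpace M]
    [ChartedSpace (EuclideanSpace ℝ (Fin m)) M] [IsManifold (𝓡 m) ∞ M] where
  /-- the endomorphism of the fibre at `x` -/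
  map : ∀ x : M, BigTangent m x →ₗ[ℝ] BigTangent m x
  smooth : ∀ s, IsSmoothSection s → IsSmoothSection (fun x => map x (s x))
  map_map : ∀ x v, map x (map x v) = 0
  skew : ∀ x v w, g x v (map x w) + g x (map x v) w = 0
  const_rank : ∃ r : ℕ, ∀ x, Module.finrank ℝ (LinearMap.range (map x)) = r

namespace TwoNilpotent

variable (τ : TwoNilpotent m M)

/-- `τ` applied to a section. -/
def app (s : ∀ x : M, BigTangent m x) (x : M) : BigTangent m x := τ.map x (s x)

/-- The Courant-Nijenhuis torsion
`N(s, t) = [τ s, τ t] - τ[s, τ t] - τ[τ s, t] + τ²[s, t]`. -/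
def nijenhuis (s t : ∀ x : M, BigTangent m x) (x : M) : BigTangent m x :=
  courant (τ.app s) (τ.app t) x - τ.map x (courant s (τ.app t) x)
    - τ.map x (courant (τ.app s) t x) + τ.map x (τ.map x (courant s t x))

/-- `τ` is integrable: its Courant-Nijenhuis torsion vanishes. -/
def IsIntegrable : Prop :=
  ∀ s t : ∀ x : M, BigTangent m x, IsSmoothSection s → IsSmoothSection t →
    ∀ x, τ.nijenhuis s t x = 0

/-- The fibre at `x` of the image bundle `E = im τ`. -/
abbrev E (x : M) : Submodule ℝ (BigTangent m x) := LinearMap.range (τ.map x)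

/-- `τ` is weakly integrable: `E = im τ` is closed under Courant brackets. -/
def IsWeaklyIntegrable : Prop :=
  ∀ s t : ∀ x : M, BigTangent m x, IsSmoothSection s → IsSmoothSection t →
    (∀ x, s x ∈ τ.E x) → (∀ x, t x ∈ τ.E x) → ∀ x, courant s t x ∈ τ.E x

/-- Smooth sections of `E`. -/
def secE : Set (∀ x, τ.E x) := {e | IsSmoothSection (fun x => (e x : BigTangent m x))}

/-- The Courant bracket on sections of `E`. The dummy value `0` is never taken on smooth sections
when `τ` is weakly integrable. -/
def bracketE (e e' : ∀ x, τ.E x) (x : M) : τ.E x :=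
  open Classical in
  if h : courant (fun y => (e y : BigTangent m y)) (fun y => (e' y : BigTangent m y)) x ∈ τ.E x
  then ⟨_, h⟩ else 0

/-- The anchor `pr_{TM} : E → TM`. -/
def anchorE (x : M) : τ.E x →ₗ[ℝ] TangentSpace (𝓡 m) x :=
  LinearMap.fst ℝ _ _ ∘ₗ (τ.E x).subtype

/-! ### The dual bundle `E*` and the bivector field `Λ` -/

/-- The fibre at `x` of the dual bundle `E*`. -/
abbrev Edual (x : M) : Type := Module.Dual ℝ (τ.E x)

/-- The map `TM ⊕ T*M → E*` given by the `g`-pairing, `v ↦ g(v, ·)|_E`. It is onto, with kernel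
`E^⊥ = ker τ`, and identifies `(TM ⊕ T*M)/E^⊥` with `E*`. -/
def toDual (x : M) : BigTangent m x →ₗ[ℝ] τ.Edual x :=
  (τ.E x).subtype.dualMap ∘ₗ g x

theorem toDual_apply (x : M) (v : BigTangent m x) (e : τ.E x) : τ.toDual x v e = g x v e := rfl

theorem toDual_surjective (x : M) : Function.Surjective (τ.toDual x) :=
  restrict_surjective (τ.E x) (g x) (g_surjective x)

theorem toDual_eq_zero_iff (x : M) (v : BigTangent m x) : τ.toDual x v = 0 ↔ τ.map x v = 0 := by
  constructor
  · intro h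
    apply g_injective x
    refine LinearMap.ext fun w => ?_
    have h1 := LinearMap.congr_fun h ⟨τ.map x w, LinearMap.mem_range_self _ w⟩
    have h2 := τ.skew x v w
    rw [toDual_apply] at h1
    simp only [LinearMap.zero_apply] at h1
    rw [h1, zero_add] at h2
    simpa using h2
  · intro h
    ext ⟨_, w, rfl⟩
    have h2 := τ.skew x v w
    rw [h] at h2
    simpa [toDual_apply] using h2

/-- Smooth sections of `E*`, which are the images under `toDual` of the smooth sections of
`TM ⊕ T*M` (the map being a smooth surjective morphism of vector bundles). -/
def secDual : Set (∀ x, τ.Edual x) :=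
  {α | ∃ s, IsSmoothSection s ∧ ∀ x, α x = τ.toDual x (s x)}

/-- `♯_Λ : E* → E`, the isomorphism induced by `τ` on `E* = (TM ⊕ T*M)/E^⊥`, i.e. the class of `v`
is mapped to `τ v`. -/
def sharp (x : M) : τ.Edual x →ₗ[ℝ] τ.E x :=
  descend (D := τ.Edual x) (W := τ.E x) (τ.toDual x) (τ.toDual_surjective x) (τ.map x).rangeRestrict
    (fun v hv => Subtype.ext ((τ.toDual_eq_zero_iff x v).1 hv))

theorem sharp_toDual (x : M) (v : BigTangent m x) :
    (τ.sharp x (τ.toDual x v) : BigTangent m x) = τ.map x v := by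
  unfold sharp
  rw [descend_apply]
  rfl

/-- `♯_Λ` applied to a section of `E*`. -/
def sharpSec (α : ∀ x, τ.Edual x) (x : M) : τ.E x := τ.sharp x (α x)

/-- The bivector field `Λ` of `E`, `Λ(α, β) = β(♯_Λ α)`; on classes of `v`, `w` its value is
`g(τ v, w)`. -/
def bivector (α β : ∀ x, τ.Edual x) (x : M) : ℝ := β x (τ.sharpSec α x)

theorem bivector_toDual (s t : ∀ x : M, BigTangent m x) (x : M) :
    τ.bivector (fun y => τ.toDual y (s y)) (fun y => τ.toDual y (t y)) x =
      g x (τ.map x (s x)) (t x) := by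
  simp only [bivector, sharpSec, toDual_apply, sharp_toDual]
  simp only [g_apply]
  ring

/-! ### Calculus on the Lie algebroid `E` and the Gelfand-Dorfman bracket -/

/-- The derivative `ρ(e)(f)` of a function along a section of `E`. -/
def derivE (e : ∀ x, τ.E x) (f : M → ℝ) (x : M) : ℝ :=
  dirDeriv (fun y => τ.anchorE y (e y)) f x

/-- The differential `d_E f ∈ Γ(E*)` of a function, `(d_E f)(e) = ρ(e)(f)`. -/
def dE (f : M → ℝ) (x : M) : τ.Edual x :=
  (mvfderiv (𝓡 m) f x).toLinearMap ∘ₗ τ.anchorE x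

/-- The Lie derivative `L_e α ∈ Γ(E*)`: the unique element with
`(L_e α)(e') = ρ(e)(α(e')) - α([e, e'])` for all smooth sections `e'` of `E`. The right-hand side
is tensorial in `e'` for `e`, `α` smooth and `τ` weakly integrable; the dummy value `0` is not taken
then. -/
def lieDual (e : ∀ x, τ.E x) (α : ∀ x, τ.Edual x) (x : M) : τ.Edual x :=
  open Classical in
  if h : ∃ ξ : τ.Edual x, ∀ e' ∈ τ.secE,
      ξ (e' x) = τ.derivE e (fun y => α y (e' y)) x - α x (τ.bracketE e e' x)
  then h.choose else 0

/-- The Gelfand-Dorfman bracket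
`{α, β}_Λ = L_{♯α} β - L_{♯β} α - d_E(Λ(α, β))` on sections of `E*`. -/
def gelfandDorfman (α β : ∀ x, τ.Edual x) (x : M) : τ.Edual x :=
  τ.lieDual (τ.sharpSec α) β x - τ.lieDual (τ.sharpSec β) α x - τ.dE (τ.bivector α β) x

/-- The composition `E* → E → TM` of `♯_Λ` with the anchor of `E`. -/
def anchorDual (x : M) : τ.Edual x →ₗ[ℝ] TangentSpace (𝓡 m) x := τ.anchorE x ∘ₗ τ.sharp x

/-- `(E*, {,}_Λ, ♯_Λ)` is a Lie algebroid with anchor `♯_Λ : E* → E`, over the Lie algebroid `E`: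
`E*` with the bracket `{,}_Λ` and the composed anchor `E* → E → TM` satisfies the axioms of a Lie
algebroid, and the anchor `♯_Λ : E* → E` preserves the brackets. -/
structure IsDualLieAlgebroid : Prop where
  lieAlgebroid : IsLieAlgebroid τ.secDual τ.gelfandDorfman τ.anchorDual
  sharp_bracket : ∀ α ∈ τ.secDual, ∀ β ∈ τ.secDual, ∀ x,
    τ.sharp x (τ.gelfandDorfman α β x) = τ.bracketE (τ.sharpSec α) (τ.sharpSec β) x

/-! ### Triangular Lie bialgebroids -/

/-- The exterior differential `d_* : Γ(E) → Γ(∧²E)` defined by the bracket and the anchor of `E*`: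
`(d_* e)(α, β) = ρ_*(α)(β(e)) - ρ_*(β)(α(e)) - {α, β}(e)`. -/
def dStar (e : ∀ x, τ.E x) (α β : ∀ x, τ.Edual x) (x : M) : ℝ :=
  dirDeriv (fun y => τ.anchorDual y (α y)) (fun y => β y (e y)) x
    - dirDeriv (fun y => τ.anchorDual y (β y)) (fun y => α y (e y)) x
    - τ.gelfandDorfman α β x (e x)

/-- The Schouten bracket `[e, P] = L_e P` of a section of `E` and a section `P` of `∧²E`, seen as a
form on sections of `E*`: `(L_e P)(α, β) = ρ(e)(P(α, β)) - P(L_e α, β) - P(α, L_e β)`. -/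
def lieBivector (e : ∀ x, τ.E x) (P : (∀ x, τ.Edual x) → (∀ x, τ.Edual x) → M → ℝ)
    (α β : ∀ x, τ.Edual x) (x : M) : ℝ :=
  τ.derivE e (P α β) x - P (τ.lieDual e α) β x - P α (τ.lieDual e β) x

/-- The Schouten bracket `[Λ, Λ] ∈ Γ(∧³E)`, by its values
`[Λ, Λ](α, β, γ) = 2 ∑ (γ([♯α, ♯β]) - ρ(♯α)(Λ(β, γ)))`, the sum being over the cyclic permutations
of `α, β, γ`. -/
def schoutenSquare (α β γ : ∀ x, τ.Edual x) (x : M) : ℝ :=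
  2 * ((γ x (τ.bracketE (τ.sharpSec α) (τ.sharpSec β) x)
        - τ.derivE (τ.sharpSec α) (τ.bivector β γ) x)
      + (α x (τ.bracketE (τ.sharpSec β) (τ.sharpSec γ) x)
        - τ.derivE (τ.sharpSec β) (τ.bivector γ α) x)
      + (β x (τ.bracketE (τ.sharpSec γ) (τ.sharpSec α) x)
        - τ.derivE (τ.sharpSec γ) (τ.bivector α β) x))

/-- `(E, E*)` is a triangular Lie bialgebroid, `E` having the Courant bracket and the anchor
`pr_{TM}`, `E*` having the bracket `{,}_Λ` and the anchor `E* → E → TM`: both are Lie algebroids,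
`d_*[e, e'] = [d_* e, e'] + [e, d_* e']`, and the structure of `E*` comes from a bivector field `Λ`
with `[Λ, Λ] = 0`. -/
structure IsTriangularLieBialgebroid : Prop where
  lieAlgebroid : IsLieAlgebroid τ.secE τ.bracketE τ.anchorE
  lieAlgebroid_dual : IsLieAlgebroid τ.secDual τ.gelfandDorfman τ.anchorDual
  compatible : ∀ e ∈ τ.secE, ∀ e' ∈ τ.secE, ∀ α ∈ τ.secDual, ∀ β ∈ τ.secDual, ∀ x,
    τ.dStar (τ.bracketE e e') α β x =
      τ.lieBivector e (τ.dStar e') α β x - τ.lieBivector e' (τ.dStar e) α β x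
  schouten : ∀ α ∈ τ.secDual, ∀ β ∈ τ.secDual, ∀ γ ∈ τ.secDual, ∀ x,
    τ.schoutenSquare α β γ x = 0

end TwoNilpotent

end GenGeom

end

noncomputable section

namespace GenGeom

variable {m : ℕ} {M : Type*} [TopologicalSpace M] [ChartedSpace (EuclideanSpace ℝ (Fin m)) M]

/-! ### Smooth functions, vector fields and 1-forms -/

/-! All the conditions reduce to the single identity ♯{α,β} = [♯α,♯β]
(`isIntegrable_iff_sharp_bracket`). For classes α = [s], β = [t], the Gelfand–Dorfman bracket is the
class of [τs,t] + [s,τt] (`gelfandDorfman_toDual`), because L_e[t] is the class of the Dorfman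
product [e,t] + ½(0, d g(e,t)) and the exact terms cancel against d_E Λ. Since τ² = 0, applying ♯
turns the identity into the vanishing of the torsion.

Skewness and τ² = 0 make E isotropic. The failures of Jacobi and Leibniz for the Courant bracket are
governed by g-pairings, which vanish on an isotropic subbundle closed under the bracket
(`courant_jacobi`, `courant_smul_right`); hence E is a Lie algebroid. As ♯ is injective, the
identity carries the axioms of E over to E* (`isLieAlgebroid_dual`).

For the bialgebroid, [Λ,Λ](α,β,γ) = 2γ([♯α,♯β] - ♯{α,β}) (`schoutenSquare_eq`), so [Λ,Λ] = 0 is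
again the same identity. The compatibility condition holds without integrability: d_*e = -L_eΛ
always, and L_[e,e'] = L_e L_e' - L_e' L_e by the Jacobi identity of E (`dStar_bracketE`). -/

theorem IsSmoothFun.mdiffAt {f : M → ℝ} (hf : IsSmoothFun m f) (x : M) :
    MDifferentiableAt (𝓡 m) 𝓘(ℝ, ℝ) f x :=
  (hf x).mdifferentiableAt (by simp)

theorem IsSmoothFun.add {f h : M → ℝ} (hf : IsSmoothFun m f) (hh : IsSmoothFun m h) :
    IsSmoothFun m (fun x => f x + h x) := ContMDiff.add hf hh

theorem IsSmoothFun.sub {f h : M → ℝ} (hf : IsSmoothFun m f) (hh : IsSmoothFun m h) :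
    IsSmoothFun m (fun x => f x - h x) := ContMDiff.sub hf hh

theorem IsSmoothFun.mul {f h : M → ℝ} (hf : IsSmoothFun m f) (hh : IsSmoothFun m h) :
    IsSmoothFun m (fun x => f x * h x) := ContMDiff.mul hf hh

theorem isSmoothFun_const (c : ℝ) : IsSmoothFun m (fun _ : M => c) := contMDiff_const

theorem dirDeriv_add {f h : M → ℝ} (X : ∀ x : M, TangentSpace (𝓡 m) x) (hf : IsSmoothFun m f)
    (hh : IsSmoothFun m h) (x : M) :
    dirDeriv X (fun y => f y + h y) x = dirDeriv X f x + dirDeriv X h x := by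
  simp only [dirDeriv]
  rw [mvfderiv_fun_add (hf.mdiffAt x) (hh.mdiffAt x)]
  rfl

theorem dirDeriv_sub {f h : M → ℝ} (X : ∀ x : M, TangentSpace (𝓡 m) x) (hf : IsSmoothFun m f)
    (hh : IsSmoothFun m h) (x : M) :
    dirDeriv X (fun y => f y - h y) x = dirDeriv X f x - dirDeriv X h x := by
  simp only [dirDeriv]
  rw [mvfderiv_fun_sub (hf.mdiffAt x) (hh.mdiffAt x)]
  rfl

theorem dirDeriv_mul {f h : M → ℝ} (X : ∀ x : M, TangentSpace (𝓡 m) x) (hf : IsSmoothFun m f)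
    (hh : IsSmoothFun m h) (x : M) :
    dirDeriv X (fun y => f y * h y) x = f x * dirDeriv X h x + h x * dirDeriv X f x := by
  simp only [dirDeriv]
  rw [mvfderiv_fun_mul (hf.mdiffAt x) (hh.mdiffAt x)]
  rfl

theorem dirDeriv_neg {f : M → ℝ} (X : ∀ x : M, TangentSpace (𝓡 m) x) (x : M) :
    dirDeriv X (fun y => -f y) x = -dirDeriv X f x := by
  simp only [dirDeriv]
  rw [mvfderiv_fun_neg]
  rfl

/-- The section `(0, df)` of the big tangent bundle. -/
def gradient (f : M → ℝ) (x : M) : BigTangent m x := (0, mvfderiv (𝓡 m) f x)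

theorem g_gradient (f : M → ℝ) (x : M) (v : BigTangent m x) :
    g x (gradient f x) v = mvfderiv (𝓡 m) f x v.1 := by
  simp [g_apply, gradient]

theorem g_comm (x : M) (v w : BigTangent m x) : g x v w = g x w v := by
  simp only [g_apply]
  ring

variable [IsManifold (𝓡 m) ∞ M]

theorem IsSmoothVectorField.mdiffAt {X : ∀ x : M, TangentSpace (𝓡 m) x}
    (hX : IsSmoothVectorField X) (x : M) :
    MDifferentiableAt (𝓡 m) (𝓡 m).tangent (fun y => (⟨y, X y⟩ : TangentBundle (𝓡 m) M)) x :=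
  (hX x).mdifferentiableAt (by simp)

theorem IsSmoothVectorField.add {X Y : ∀ x : M, TangentSpace (𝓡 m) x}
    (hX : IsSmoothVectorField X) (hY : IsSmoothVectorField Y) :
    IsSmoothVectorField (fun x => X x + Y x) := ContMDiff.add_section hX hY

theorem IsSmoothVectorField.smul {f : M → ℝ} {X : ∀ x : M, TangentSpace (𝓡 m) x}
    (hf : IsSmoothFun m f) (hX : IsSmoothVectorField X) :
    IsSmoothVectorField (fun x => f x • X x) := ContMDiff.smul_section hf hX

theorem IsSmoothVectorField.mlieBracket {X Y : ∀ x : M, TangentSpace (𝓡 m) x}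
    (hX : IsSmoothVectorField X) (hY : IsSmoothVectorField Y) :
    IsSmoothVectorField (VectorField.mlieBracket (𝓡 m) X Y) := by
  -- The bracket loses one derivative, which costs nothing since ∞ + 1 = ∞.
  have : IsManifold (𝓡 m) (((⊤ : ℕ∞) : WithTop ℕ∞) + 1) M := by
    change IsManifold (𝓡 m) ∞ M
    infer_instance
  have : IsManifold (𝓡 m) (minSmoothness ℝ 2) M := by
    apply IsManifold.of_le (n := ∞)
    rw [minSmoothness_of_isRCLikeNormedField]
    exact ENat.LEInfty.out
  exact ContDiff.mlieBracket_vectorField (m := (⊤ : ℕ∞)) (n := (⊤ : ℕ∞)) hX hY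
    (by simp [minSmoothness_of_isRCLikeNormedField])

theorem IsSmoothOneForm.apply {α : ∀ x : M, Cotangent m x} {X : ∀ x : M, TangentSpace (𝓡 m) x}
    (hα : IsSmoothOneForm α) (hX : IsSmoothVectorField X) :
    IsSmoothFun m (fun x => α x (X x)) := by
  have h := ContMDiff.clm_bundle_apply (E₂ := fun y : M => Bundle.Trivial M ℝ y)
    (F₂ := ℝ) hα hX
  intro x
  have h := h x
  rw [Bundle.contMDiffAt_section] at h
  exact h

theorem IsSmoothFun.dirDeriv {f : M → ℝ} {X : ∀ x : M, TangentSpace (𝓡 m) x}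
    (hX : IsSmoothVectorField X) (hf : IsSmoothFun m f) : IsSmoothFun m (dirDeriv X f) := by
  -- X(f) is the fibre component of the composition of the tangent map of f with X.
  have h1 : ContMDiff (𝓡 m).tangent 𝓘(ℝ, ℝ).tangent ∞ (tangentMap (𝓡 m) 𝓘(ℝ, ℝ) f) :=
    ContMDiff.contMDiff_tangentMap (n := ∞) hf (by simp)
  exact (contMDiff_snd_tangentBundle_modelSpace ℝ 𝓘(ℝ, ℝ)).comp (h1.comp hX)

theorem mlieBracket_fun_smul_right {f : M → ℝ} {X Y : ∀ x : M, TangentSpace (𝓡 m) x}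
    (hf : IsSmoothFun m f) (hY : IsSmoothVectorField Y) (x : M) :
    VectorField.mlieBracket (𝓡 m) X (fun y => f y • Y y) x =
      dirDeriv X f x • Y x + f x • VectorField.mlieBracket (𝓡 m) X Y x :=
  VectorField.mlieBracket_smul_right (hf.mdiffAt x) (hY.mdiffAt x)

theorem mlieBracket_jacobi {X Y Z : ∀ x : M, TangentSpace (𝓡 m) x} (hX : IsSmoothVectorField X)
    (hY : IsSmoothVectorField Y) (hZ : IsSmoothVectorField Z) (x : M) :
    VectorField.mlieBracket (𝓡 m) X (VectorField.mlieBracket (𝓡 m) Y Z) x =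
      VectorField.mlieBracket (𝓡 m) (VectorField.mlieBracket (𝓡 m) X Y) Z x
        + VectorField.mlieBracket (𝓡 m) Y (VectorField.mlieBracket (𝓡 m) X Z) x := by
  have h2 : minSmoothness ℝ 2 ≤ (∞ : WithTop ℕ∞) := by
    rw [minSmoothness_of_isRCLikeNormedField]
    exact ENat.LEInfty.out
  have h3 : IsManifold (𝓡 m) (minSmoothness ℝ 3) M := by
    apply IsManifold.of_le (n := ∞)
    rw [minSmoothness_of_isRCLikeNormedField]
    exact ENat.LEInfty.out
  exact VectorField.leibniz_identity_mlieBracket_apply ((hX x).of_le h2) ((hY x).of_le h2)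
    ((hZ x).of_le h2)

theorem isSmoothVectorField_zero : IsSmoothVectorField (fun x : M => (0 : TangentSpace (𝓡 m) x)) :=
  Bundle.contMDiff_zeroSection ℝ (TangentSpace (𝓡 m) : M → Type)

/-! ### Global sections through prescribed values, and tests on them -/

section Extension

variable [T2Space M]

section Bundle

variable {F : Type*} [NormedAddCommGroup F] [NormedSpace ℝ F] {V : M → Type*}
  [∀ x, AddCommGroup (V x)] [∀ x, Module ℝ (V x)] [∀ x, TopologicalSpace (V x)]
  [TopologicalSpace (Bundle.TotalSpace F V)] [FiberBundle F V] [VectorBundle ℝ F V]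

/-- A section that is smooth near `x` agrees near `x` with a global smooth section. -/
theorem exists_contMDiff_eventuallyEq {x : M} {U : Set M} (hU : IsOpen U) (hx : x ∈ U)
    {W : ∀ x : M, V x}
    (hW : ContMDiffOn (𝓡 m) ((𝓡 m).prod 𝓘(ℝ, F)) ∞ (fun y => Bundle.TotalSpace.mk' F y (W y)) U) :
    ∃ Z : ∀ x : M, V x,
      ContMDiff (𝓡 m) ((𝓡 m).prod 𝓘(ℝ, F)) ∞ (fun y => Bundle.TotalSpace.mk' F y (Z y)) ∧
      ∀ᶠ y in nhds x, Z y = W y := by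
  -- A bump function equal to 1 near x with closed support in U: the product ψW is smooth on all of
  -- M.
  obtain ⟨ψ, -, hψ⟩ := (SmoothBumpFunction.nhds_basis_tsupport (I := 𝓡 m) x).mem_iff.1
    (hU.mem_nhds hx)
  refine ⟨fun y => ψ y • W y, ?_, ?_⟩
  · exact ContMDiffOn.smul_section_of_tsupport ψ.contMDiff.contMDiffOn hU hψ hW
  · filter_upwards [ψ.eventuallyEq_one] with y hy
    rw [hy]
    simp

theorem exists_contMDiff_section_eq [ContMDiffVectorBundle ∞ F V (𝓡 m)] {x : M} (v : V x) :
    ∃ Z : ∀ x : M, V x,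
      ContMDiff (𝓡 m) ((𝓡 m).prod 𝓘(ℝ, F)) ∞ (fun y => Bundle.TotalSpace.mk' F y (Z y)) ∧
      Z x = v := by
  obtain ⟨s, hs, hW⟩ := FiberBundle.exists_contMDiffOn_extend (𝓡 m) F (k := ∞) v
  obtain ⟨U, hUs, hU, hx⟩ := mem_nhds_iff.1 hs
  obtain ⟨Z, hZ, hZW⟩ := exists_contMDiff_eventuallyEq hU hx (hW.mono hUs)
  refine ⟨Z, hZ, hZW.self_of_nhds.trans ?_⟩
  simp

end Bundle

theorem exists_smooth_vectorField {x : M} (v : TangentSpace (𝓡 m) x) :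
    ∃ Z : ∀ x : M, TangentSpace (𝓡 m) x, IsSmoothVectorField Z ∧ Z x = v :=
  exists_contMDiff_section_eq v

theorem exists_smooth_oneForm {x : M} (φ : Cotangent m x) :
    ∃ α : ∀ x : M, Cotangent m x, IsSmoothOneForm α ∧ α x = φ :=
  exists_contMDiff_section_eq (F := EuclideanSpace ℝ (Fin m) →L[ℝ] ℝ)
    (V := fun x : M => TangentSpace (𝓡 m) x →L[ℝ] Bundle.Trivial M ℝ x) φ

/-- Lie derivatives of forms are known only through their values on smooth vector fields; since
these fill each tangent space, identities of forms can be checked there. -/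
theorem cotangent_ext {x : M} {α β : Cotangent m x}
    (h : ∀ Z : ∀ x : M, TangentSpace (𝓡 m) x, IsSmoothVectorField Z → α (Z x) = β (Z x)) :
    α = β := by
  ext v
  obtain ⟨Z, hZ, rfl⟩ := exists_smooth_vectorField v
  exact h Z hZ

/-- A family of covectors is smooth if its values on smooth vector fields are smooth. -/
theorem isSmoothOneForm_of_apply {α : ∀ x : M, Cotangent m x}
    (h : ∀ Z : ∀ x : M, TangentSpace (𝓡 m) x, IsSmoothVectorField Z →
      IsSmoothFun m (fun x => α x (Z x))) : IsSmoothOneForm α := by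
  intro x
  rw [contMDiffAt_hom_bundle]
  refine ⟨contMDiffAt_id, ?_⟩
  set e := trivializationAt (EuclideanSpace ℝ (Fin m)) (TangentSpace (𝓡 m) : M → Type) x with he
  set b := (EuclideanSpace.basisFun (Fin m) ℝ).toBasis with hb
  have hx : x ∈ e.baseSet := FiberBundle.mem_baseSet_trivializationAt' x
  have hfr : ∀ i, ContMDiffOn (𝓡 m) (𝓡 m).tangent ∞
      (fun y => (⟨y, e.localFrame b i y⟩ : TangentBundle (𝓡 m) M)) e.baseSet :=
    fun i => e.contMDiffOn_localFrame_baseSet ∞ b i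
  -- The local frame near x is replaced by global fields with the same germs, so that the hypothesis
  -- applies; the functions α(Z i) are then the coordinates of α.
  choose Z hZ hZW using fun i => exists_contMDiff_eventuallyEq e.open_baseSet hx (hfr i)
  have hsum : ContMDiffAt (𝓡 m) 𝓘(ℝ, EuclideanSpace ℝ (Fin m) →L[ℝ] ℝ) ∞
      (fun y => ∑ i, α y (Z i y) • (EuclideanSpace.proj i : EuclideanSpace ℝ (Fin m) →L[ℝ] ℝ)) x :=
    contMDiffAt_finsetSum fun i _ => ((h (Z i) (hZ i)) x).smul contMDiffAt_const
  refine hsum.congr_of_eventuallyEq ?_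
  filter_upwards [Filter.eventually_all.2 hZW, e.open_baseSet.mem_nhds hx] with y hy hye
  rw [ContinuousLinearMap.inCoordinates_eq hye (by simp)]
  apply ContinuousLinearMap.coe_injective
  apply b.ext
  intro i
  rw [ContinuousLinearMap.coe_coe, ContinuousLinearMap.coe_coe]
  simp only [hy, e.localFrame_apply_of_mem_baseSet b hye]
  simp [hb, Bundle.Trivialization.basisAt]
  rfl

theorem IsSmoothOneForm.add {α β : ∀ x : M, Cotangent m x} (hα : IsSmoothOneForm α)
    (hβ : IsSmoothOneForm β) : IsSmoothOneForm (fun x => α x + β x) :=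
  isSmoothOneForm_of_apply fun _ hZ => (hα.apply hZ).add (hβ.apply hZ)

theorem IsSmoothOneForm.sub {α β : ∀ x : M, Cotangent m x} (hα : IsSmoothOneForm α)
    (hβ : IsSmoothOneForm β) : IsSmoothOneForm (fun x => α x - β x) :=
  isSmoothOneForm_of_apply fun _ hZ => (hα.apply hZ).sub (hβ.apply hZ)

theorem IsSmoothOneForm.smul {f : M → ℝ} {α : ∀ x : M, Cotangent m x} (hf : IsSmoothFun m f)
    (hα : IsSmoothOneForm α) : IsSmoothOneForm (fun x => f x • α x) :=
  isSmoothOneForm_of_apply fun _ hZ => hf.mul (hα.apply hZ)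

theorem IsSmoothFun.mvfderiv {f : M → ℝ} (hf : IsSmoothFun m f) :
    IsSmoothOneForm (mvfderiv (𝓡 m) f) :=
  isSmoothOneForm_of_apply fun _ hZ => hf.dirDeriv hZ

theorem IsSmoothOneForm.lieForm {X : ∀ x : M, TangentSpace (𝓡 m) x} {μ : ∀ x : M, Cotangent m x}
    (hX : IsSmoothVectorField X) (hμ : IsSmoothOneForm μ) : IsSmoothOneForm (lieForm X μ) := by
  refine isSmoothOneForm_of_apply fun Z hZ => ?_
  simp only [lieForm_apply hμ hZ]
  exact ((hμ.apply hZ).dirDeriv hX).sub (hμ.apply (hX.mlieBracket hZ))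

/-- The bracket of vector fields is the commutator of the derivations. -/
theorem dirDeriv_mlieBracket {X Y : ∀ x : M, TangentSpace (𝓡 m) x} {f : M → ℝ}
    (hX : IsSmoothVectorField X) (hY : IsSmoothVectorField Y) (hf : IsSmoothFun m f) (x : M) :
    dirDeriv (VectorField.mlieBracket (𝓡 m) X Y) f x =
      dirDeriv X (dirDeriv Y f) x - dirDeriv Y (dirDeriv X f) x := by
  -- If the tangent space at x has a nonzero vector, extend it to Z and expand the Jacobi identity
  -- for X, Y, fZ: the Jacobi identity for X, Y, Z removes the terms in f, and what is left is a
  -- multiple of Z x.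
  by_cases hs : ∃ v : TangentSpace (𝓡 m) x, v ≠ 0
  · obtain ⟨v, hv⟩ := hs
    obtain ⟨Z, hZ, rfl⟩ := exists_smooth_vectorField v
    have e1 : ∀ {U : ∀ x : M, TangentSpace (𝓡 m) x},
        VectorField.mlieBracket (𝓡 m) U (fun y => f y • Z y) =
          (fun y => dirDeriv U f y • Z y) + fun y => f y • VectorField.mlieBracket (𝓡 m) U Z y :=
      fun {U} => funext fun y => mlieBracket_fun_smul_right hf hZ y
    have e2 : ∀ {U V : ∀ x : M, TangentSpace (𝓡 m) x}, IsSmoothVectorField U →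
        IsSmoothVectorField V →
        VectorField.mlieBracket (𝓡 m) U (VectorField.mlieBracket (𝓡 m) V (fun y => f y • Z y)) x =
          dirDeriv U (dirDeriv V f) x • Z x
            + dirDeriv V f x • VectorField.mlieBracket (𝓡 m) U Z x
            + (dirDeriv U f x • VectorField.mlieBracket (𝓡 m) V Z x
              + f x • VectorField.mlieBracket (𝓡 m) U (VectorField.mlieBracket (𝓡 m) V Z) x) := by
      intro U V hU hV
      rw [e1, VectorField.mlieBracket_add_right
        ((IsSmoothVectorField.smul (hf.dirDeriv hV) hZ).mdiffAt x)
        ((IsSmoothVectorField.smul hf (hV.mlieBracket hZ)).mdiffAt x),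
        mlieBracket_fun_smul_right (hf.dirDeriv hV) hZ,
        mlieBracket_fun_smul_right hf (hV.mlieBracket hZ)]
    have h := mlieBracket_jacobi hX hY (IsSmoothVectorField.smul hf hZ) x
    rw [e2 hX hY, e2 hY hX, e1, Pi.add_apply, mlieBracket_jacobi hX hY hZ x] at h
    have h' : (dirDeriv X (dirDeriv Y f) x - dirDeriv Y (dirDeriv X f) x
        - dirDeriv (VectorField.mlieBracket (𝓡 m) X Y) f x) • Z x = 0 := by
      rw [sub_smul, sub_smul]
      rw [← sub_eq_zero] at h
      rw [← h, smul_add]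
      abel
    have := (smul_eq_zero.1 h').resolve_right hv
    linarith
  -- The tangent space at x is zero, so both sides vanish.
  · push Not at hs
    simp only [dirDeriv]
    rw [hs (X x), hs (Y x), hs (VectorField.mlieBracket (𝓡 m) X Y x)]
    simp

end Extension

/-! ### Properties of the Courant bracket -/

theorem IsSmoothSection.g {s t : ∀ x : M, BigTangent m x} (hs : IsSmoothSection s)
    (ht : IsSmoothSection t) : IsSmoothFun m (fun x => g x (s x) (t x)) :=
  (hs.2.apply ht.1).add (ht.2.apply hs.1)

theorem courant_swap (s t : ∀ x : M, BigTangent m x) (x : M) : courant s t x = -courant t s x := by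
  have h : (fun y => (s y).2 (t y).1 - (t y).2 (s y).1) =
      -fun y => (t y).2 (s y).1 - (s y).2 (t y).1 := by
    funext y
    simp
  refine Prod.ext VectorField.mlieBracket_swap_apply ?_
  simp only [courant, Prod.snd_neg]
  rw [h, mvfderiv_neg, smul_neg]
  abel

theorem courant_fst (s t : ∀ x : M, BigTangent m x) (x : M) :
    (courant s t x).1 =
      VectorField.mlieBracket (𝓡 m) (fun y => (s y).1) (fun y => (t y).1) x := rfl

theorem courant_snd_apply {s t : ∀ x : M, BigTangent m x} (hs : IsSmoothSection s)
    (ht : IsSmoothSection t) {Z : ∀ x : M, TangentSpace (𝓡 m) x} (hZ : IsSmoothVectorField Z)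
    (x : M) :
    (courant s t x).2 (Z x) =
      dirDeriv (fun y => (s y).1) (fun y => (t y).2 (Z y)) x
        - (t x).2 (VectorField.mlieBracket (𝓡 m) (fun y => (s y).1) Z x)
        - (dirDeriv (fun y => (t y).1) (fun y => (s y).2 (Z y)) x
          - (s x).2 (VectorField.mlieBracket (𝓡 m) (fun y => (t y).1) Z x))
        + 1 / 2 * (dirDeriv Z (fun y => (s y).2 (t y).1) x
          - dirDeriv Z (fun y => (t y).2 (s y).1) x) := by
  rw [← lieForm_apply ht.2 hZ, ← lieForm_apply hs.2 hZ,
    ← dirDeriv_sub Z (hs.2.apply ht.1) (ht.2.apply hs.1)]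
  rfl

/-- Invariance of g under the Dorfman product [s,t] + ½(0, d g(s,t)); the half-derivatives are the
correction for the skew bracket. -/
theorem dirDeriv_g {s t u : ∀ x : M, BigTangent m x} (hs : IsSmoothSection s)
    (ht : IsSmoothSection t) (hu : IsSmoothSection u) (x : M) :
    dirDeriv (fun y => (s y).1) (fun y => g y (t y) (u y)) x =
      g x (courant s t x) (u x) + 1 / 2 * dirDeriv (fun y => (u y).1) (fun y => g y (s y) (t y)) x
        + (g x (courant s u x) (t x)
          + 1 / 2 * dirDeriv (fun y => (t y).1) (fun y => g y (s y) (u y)) x) := by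
  simp only [g_apply]
  rw [dirDeriv_add _ (ht.2.apply hu.1) (hu.2.apply ht.1),
    dirDeriv_add _ (hs.2.apply ht.1) (ht.2.apply hs.1),
    dirDeriv_add _ (hs.2.apply hu.1) (hu.2.apply hs.1), courant_snd_apply hs ht hu.1,
    courant_snd_apply hs hu ht.1, courant_fst, courant_fst,
    VectorField.mlieBracket_swap_apply (V := fun y => (u y).1) (W := fun y => (t y).1)]
  rw [map_neg]
  ring

section Courant

variable [T2Space M]

theorem lieForm_add_left {X X' : ∀ x : M, TangentSpace (𝓡 m) x} {μ : ∀ x : M, Cotangent m x}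
    (hX : IsSmoothVectorField X) (hX' : IsSmoothVectorField X') (hμ : IsSmoothOneForm μ) (x : M) :
    lieForm (fun y => X y + X' y) μ x = lieForm X μ x + lieForm X' μ x := by
  refine cotangent_ext fun Z hZ => ?_
  have h : VectorField.mlieBracket (𝓡 m) (fun y => X y + X' y) Z x =
      VectorField.mlieBracket (𝓡 m) X Z x + VectorField.mlieBracket (𝓡 m) X' Z x :=
    VectorField.mlieBracket_add_left (hX.mdiffAt x) (hX'.mdiffAt x)
  rw [add_apply, lieForm_apply hμ hZ, lieForm_apply hμ hZ,
    lieForm_apply hμ hZ, h]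
  simp only [dirDeriv, map_add]
  ring

theorem lieForm_add_right {X : ∀ x : M, TangentSpace (𝓡 m) x} {μ μ' : ∀ x : M, Cotangent m x}
    (hμ : IsSmoothOneForm μ) (hμ' : IsSmoothOneForm μ') (x : M) :
    lieForm X (fun y => μ y + μ' y) x = lieForm X μ x + lieForm X μ' x := by
  refine cotangent_ext fun Z hZ => ?_
  rw [add_apply, lieForm_apply (hμ.add hμ') hZ, lieForm_apply hμ hZ,
    lieForm_apply hμ' hZ]
  simp only [add_apply]
  rw [dirDeriv_add X (hμ.apply hZ) (hμ'.apply hZ)]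
  ring

theorem lieForm_smul_left {X : ∀ x : M, TangentSpace (𝓡 m) x} {μ : ∀ x : M, Cotangent m x}
    {f : M → ℝ} (hf : IsSmoothFun m f) (hX : IsSmoothVectorField X) (hμ : IsSmoothOneForm μ)
    (x : M) :
    lieForm (fun y => f y • X y) μ x = f x • lieForm X μ x + μ x (X x) • mvfderiv (𝓡 m) f x := by
  refine cotangent_ext fun Z hZ => ?_
  have h : VectorField.mlieBracket (𝓡 m) (fun y => f y • X y) Z x =
      -mvfderiv (𝓡 m) f x (Z x) • X x + f x • VectorField.mlieBracket (𝓡 m) X Z x :=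
    VectorField.mlieBracket_smul_left (hf.mdiffAt x) (hX.mdiffAt x)
  rw [add_apply, smul_apply,
    smul_apply, lieForm_apply hμ hZ, lieForm_apply hμ hZ, h]
  simp only [dirDeriv, map_add, map_smul, smul_eq_mul]
  ring

theorem lieForm_smul_right {X : ∀ x : M, TangentSpace (𝓡 m) x} {μ : ∀ x : M, Cotangent m x}
    {f : M → ℝ} (hf : IsSmoothFun m f) (hμ : IsSmoothOneForm μ) (x : M) :
    lieForm X (fun y => f y • μ y) x = f x • lieForm X μ x + dirDeriv X f x • μ x := by
  refine cotangent_ext fun Z hZ => ?_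
  rw [add_apply, smul_apply,
    smul_apply, lieForm_apply (IsSmoothOneForm.smul hf hμ) hZ,
    lieForm_apply hμ hZ]
  simp only [smul_apply, smul_eq_mul]
  rw [dirDeriv_mul X hf (hμ.apply hZ)]
  ring

theorem exists_smooth_section {x : M} (v : BigTangent m x) :
    ∃ s : ∀ x : M, BigTangent m x, IsSmoothSection s ∧ s x = v := by
  obtain ⟨X, hX, hXv⟩ := exists_smooth_vectorField v.1
  obtain ⟨α, hα, hαv⟩ := exists_smooth_oneForm v.2
  exact ⟨fun y => (X y, α y), ⟨hX, hα⟩, Prod.ext hXv hαv⟩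

theorem IsSmoothSection.add {s t : ∀ x : M, BigTangent m x} (hs : IsSmoothSection s)
    (ht : IsSmoothSection t) : IsSmoothSection (fun x => s x + t x) :=
  ⟨hs.1.add ht.1, hs.2.add ht.2⟩

theorem IsSmoothSection.smul {f : M → ℝ} {s : ∀ x : M, BigTangent m x} (hf : IsSmoothFun m f)
    (hs : IsSmoothSection s) : IsSmoothSection (fun x => f x • s x) :=
  ⟨IsSmoothVectorField.smul hf hs.1, IsSmoothOneForm.smul hf hs.2⟩

theorem IsSmoothSection.courant {s t : ∀ x : M, BigTangent m x} (hs : IsSmoothSection s)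
    (ht : IsSmoothSection t) : IsSmoothSection (courant s t) :=
  ⟨hs.1.mlieBracket ht.1, ((ht.2.lieForm hs.1).sub (hs.2.lieForm ht.1)).add
    (IsSmoothOneForm.smul (isSmoothFun_const _)
      ((hs.2.apply ht.1).sub (ht.2.apply hs.1)).mvfderiv)⟩

theorem IsSmoothFun.gradient {f : M → ℝ} (hf : IsSmoothFun m f) :
    IsSmoothSection (gradient (m := m) f) :=
  ⟨isSmoothVectorField_zero, hf.mvfderiv⟩

theorem courant_add_left {s s' t : ∀ x : M, BigTangent m x} (hs : IsSmoothSection s)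
    (hs' : IsSmoothSection s') (ht : IsSmoothSection t) (x : M) :
    courant (fun y => s y + s' y) t x = courant s t x + courant s' t x := by
  refine Prod.ext (VectorField.mlieBracket_add_left (hs.1.mdiffAt x) (hs'.1.mdiffAt x)) ?_
  have h : (fun y => (s y + s' y).2 (t y).1 - (t y).2 (s y + s' y).1) =
      fun y => ((s y).2 (t y).1 - (t y).2 (s y).1) + ((s' y).2 (t y).1 - (t y).2 (s' y).1) := by
    funext y
    simp
    ring
  simp only [courant]
  rw [h, mvfderiv_fun_add (((hs.2.apply ht.1).sub (ht.2.apply hs.1)).mdiffAt x)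
    (((hs'.2.apply ht.1).sub (ht.2.apply hs'.1)).mdiffAt x)]
  simp only [Prod.fst_add, Prod.snd_add]
  rw [lieForm_add_left hs.1 hs'.1 ht.2, lieForm_add_right hs.2 hs'.2, smul_add]
  abel

/-- The last term is the obstruction to the Leibniz rule; it disappears for sections of an isotropic
subbundle. -/
theorem courant_smul_right {s t : ∀ x : M, BigTangent m x} {f : M → ℝ} (hs : IsSmoothSection s)
    (ht : IsSmoothSection t) (hf : IsSmoothFun m f) (x : M) :
    courant s (fun y => f y • t y) x =
      f x • courant s t x + dirDeriv (fun y => (s y).1) f x • t x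
        - (1 / 2 * g x (s x) (t x)) • gradient f x := by
  refine Prod.ext ?_ ?_
  · rw [courant_fst]
    simp only [Prod.smul_fst, Prod.fst_sub, Prod.fst_add, courant_fst, gradient]
    rw [mlieBracket_fun_smul_right hf ht.1, add_comm]
    simp
  · have h : (fun y => (s y).2 (f y • t y).1 - (f y • t y).2 (s y).1) =
        fun y => f y * ((s y).2 (t y).1 - (t y).2 (s y).1) := by
      funext y
      simp
      ring
    simp only [courant, gradient]
    rw [h, mvfderiv_fun_mul (hf.mdiffAt x) (((hs.2.apply ht.1).sub (ht.2.apply hs.1)).mdiffAt x)]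
    simp only [Prod.snd_sub, Prod.snd_add, Prod.smul_snd, Prod.smul_fst]
    rw [lieForm_smul_left hf ht.1 hs.2, lieForm_smul_right hf ht.2, g_apply]
    ext v
    simp
    ring

/-- The form part of `[[a, b], c]` when `a`, `b` and `[a, b]`, `c` are `g`-orthogonal. -/
theorem courant_courant_snd_apply {a b c : ∀ x : M, BigTangent m x} (ha : IsSmoothSection a)
    (hb : IsSmoothSection b) (hc : IsSmoothSection c) (hab : ∀ x, g x (a x) (b x) = 0)
    (habc : ∀ x, g x (courant a b x) (c x) = 0)
    {Z : ∀ x : M, TangentSpace (𝓡 m) x} (hZ : IsSmoothVectorField Z) (x : M)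
    {X Y W : ∀ x : M, TangentSpace (𝓡 m) x} {α β γ : ∀ x : M, Cotangent m x}
    (hX : X = fun y => (a y).1) (hY : Y = fun y => (b y).1) (hW : W = fun y => (c y).1)
    (hα : α = fun y => (a y).2) (hβ : β = fun y => (b y).2) (hγ : γ = fun y => (c y).2) :
    (courant (courant a b) c x).2 (Z x) =
      dirDeriv X (dirDeriv Y (fun y => γ y (Z y))) x - dirDeriv Y (dirDeriv X (fun y => γ y (Z y))) x
        - γ x (VectorField.mlieBracket (𝓡 m) (VectorField.mlieBracket (𝓡 m) X Y) Z x)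
        - (dirDeriv W (dirDeriv X (fun y => β y (Z y))) x
          - dirDeriv W (fun y => β y (VectorField.mlieBracket (𝓡 m) X Z y)) x
          - (dirDeriv W (dirDeriv Y (fun y => α y (Z y))) x
            - dirDeriv W (fun y => α y (VectorField.mlieBracket (𝓡 m) Y Z y)) x))
        + (dirDeriv X (fun y => β y (VectorField.mlieBracket (𝓡 m) W Z y)) x
          - β x (VectorField.mlieBracket (𝓡 m) X (VectorField.mlieBracket (𝓡 m) W Z) x)
          - (dirDeriv Y (fun y => α y (VectorField.mlieBracket (𝓡 m) W Z y)) x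
            - α x (VectorField.mlieBracket (𝓡 m) Y (VectorField.mlieBracket (𝓡 m) W Z) x)))
        - dirDeriv Z (dirDeriv W (fun y => α y (Y y))) x
        - dirDeriv Z (fun y => γ y (VectorField.mlieBracket (𝓡 m) X Y y)) x := by
  have sX : IsSmoothVectorField X := hX ▸ ha.1
  have sY : IsSmoothVectorField Y := hY ▸ hb.1
  have sW : IsSmoothVectorField W := hW ▸ hc.1
  have sα : IsSmoothOneForm α := hα ▸ ha.2
  have sβ : IsSmoothOneForm β := hβ ▸ hb.2
  have sγ : IsSmoothOneForm γ := hγ ▸ hc.2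
  -- Orthogonality of [a,b] and c.
  have hωW : (fun y => (courant a b y).2 (W y)) =
      fun y => -γ y (VectorField.mlieBracket (𝓡 m) X Y y) := by
    funext y
    have := habc y
    rw [g_apply] at this
    subst hX hY hW hγ
    linarith!
  -- Orthogonality of a and b gives β(X) = -α(Y), so ½ d(α(Y) - β(X)) is d(α(Y)).
  have hω : ∀ {V : ∀ x : M, TangentSpace (𝓡 m) x}, IsSmoothVectorField V →
      ∀ y, (courant a b y).2 (V y) = dirDeriv X (fun y => β y (V y)) y
        - β y (VectorField.mlieBracket (𝓡 m) X V y)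
        - (dirDeriv Y (fun y => α y (V y)) y - α y (VectorField.mlieBracket (𝓡 m) Y V y))
        + dirDeriv V (fun y => α y (Y y)) y := by
    intro V hV y
    have h0 : (fun y => β y (X y)) = fun y => -α y (Y y) := by
      funext y
      have := hab y
      rw [g_apply] at this
      subst hX hY hα hβ
      linarith
    have := courant_snd_apply ha hb hV y
    subst hX hY hα hβ
    rw [this, h0, dirDeriv_neg]
    ring
  have h1 := courant_snd_apply (ha.courant hb) hc hZ x
  have h2 : ∀ y, (courant a b y).1 = VectorField.mlieBracket (𝓡 m) X Y y := by
    subst hX hY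
    exact fun y => rfl
  have h3 : (fun y => (c y).2 (courant a b y).1) =
      fun y => γ y (VectorField.mlieBracket (𝓡 m) X Y y) := by
    subst hγ
    exact funext fun y => by rw [h2]
  rw [h3] at h1
  simp only [h2] at h1
  rw [← hW] at h1
  -- In the expansion of L_W of the form part of [a,b], the derivative of α(Y) along [W,Z] cancels
  -- W(Z(α(Y))) and leaves -Z(W(α(Y))).
  rw [show (fun y => (courant a b y).2 (c y).1) = fun y => (courant a b y).2 (W y) by
    subst hW; rfl, hωW, dirDeriv_neg, show (fun y => (c y).2 (Z y)) = fun y => γ y (Z y) by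
    subst hγ; rfl, show (c x).2 = γ x by subst hγ; rfl, funext (hω hZ), hω (sW.mlieBracket hZ),
    dirDeriv_add, dirDeriv_sub, dirDeriv_sub, dirDeriv_sub,
    dirDeriv_mlieBracket sX sY (sγ.apply hZ), dirDeriv_mlieBracket sW hZ (sα.apply sY)] at h1
  · rw [h1]
    ring
  all_goals
    repeat' first
      | assumption
      | apply IsSmoothFun.sub
      | apply IsSmoothFun.add
      | apply IsSmoothFun.dirDeriv
      | apply IsSmoothOneForm.apply
      | apply IsSmoothVectorField.mlieBracket

/-- The vector part is the Jacobi identity of vector fields. In the form part, the cyclic sum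
reduces by that same identity to the differential of an expression in the pairings, which the
orthogonality hypotheses make zero. -/
theorem courant_jacobi {a b c : ∀ x : M, BigTangent m x} (ha : IsSmoothSection a)
    (hb : IsSmoothSection b) (hc : IsSmoothSection c) (hab : ∀ x, g x (a x) (b x) = 0)
    (hbc : ∀ x, g x (b x) (c x) = 0) (hca : ∀ x, g x (c x) (a x) = 0)
    (habc : ∀ x, g x (courant a b x) (c x) = 0) (hbca : ∀ x, g x (courant b c x) (a x) = 0)
    (hcab : ∀ x, g x (courant c a x) (b x) = 0) (x : M) :
    courant (courant a b) c x + courant (courant b c) a x + courant (courant c a) b x = 0 := by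
  obtain ⟨X, hX⟩ : ∃ X : ∀ x : M, TangentSpace (𝓡 m) x, X = fun y => (a y).1 := ⟨_, rfl⟩
  obtain ⟨Y, hY⟩ : ∃ X : ∀ x : M, TangentSpace (𝓡 m) x, X = fun y => (b y).1 := ⟨_, rfl⟩
  obtain ⟨W, hW⟩ : ∃ X : ∀ x : M, TangentSpace (𝓡 m) x, X = fun y => (c y).1 := ⟨_, rfl⟩
  obtain ⟨α, hα⟩ : ∃ α : ∀ x : M, Cotangent m x, α = fun y => (a y).2 := ⟨_, rfl⟩
  obtain ⟨β, hβ⟩ : ∃ α : ∀ x : M, Cotangent m x, α = fun y => (b y).2 := ⟨_, rfl⟩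
  obtain ⟨γ, hγ⟩ : ∃ α : ∀ x : M, Cotangent m x, α = fun y => (c y).2 := ⟨_, rfl⟩
  have sX : IsSmoothVectorField X := hX ▸ ha.1
  have sY : IsSmoothVectorField Y := hY ▸ hb.1
  have sW : IsSmoothVectorField W := hW ▸ hc.1
  have sα : IsSmoothOneForm α := hα ▸ ha.2
  have sβ : IsSmoothOneForm β := hβ ▸ hb.2
  have sγ : IsSmoothOneForm γ := hγ ▸ hc.2
  refine Prod.ext ?_ ?_
  · have h := mlieBracket_jacobi sX sY sW x
    have e1 : (courant (courant a b) c x).1 =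
        VectorField.mlieBracket (𝓡 m) (VectorField.mlieBracket (𝓡 m) X Y) W x := by
      subst hX hY hW; rfl
    have e2 : (courant (courant b c) a x).1 =
        VectorField.mlieBracket (𝓡 m) (VectorField.mlieBracket (𝓡 m) Y W) X x := by
      subst hX hY hW; rfl
    have e3 : (courant (courant c a) b x).1 =
        VectorField.mlieBracket (𝓡 m) (VectorField.mlieBracket (𝓡 m) W X) Y x := by
      subst hX hY hW; rfl
    rw [Prod.fst_add, Prod.fst_add, e1, e2, e3, Prod.fst_zero,
      VectorField.mlieBracket_swap_apply (V := VectorField.mlieBracket (𝓡 m) Y W), h,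
      VectorField.mlieBracket_swap (V := W) (W := X),
      VectorField.mlieBracket_swap_apply (V := -VectorField.mlieBracket (𝓡 m) X W)]
    have h' : VectorField.mlieBracket (𝓡 m) Y (-VectorField.mlieBracket (𝓡 m) X W) x =
        -VectorField.mlieBracket (𝓡 m) Y (VectorField.mlieBracket (𝓡 m) X W) x := by
      have := VectorField.mlieBracket_const_smul_right (I := 𝓡 m) (V := Y) (c := (-1 : ℝ))
        ((sX.mlieBracket sW).mdiffAt x)
      simpa using this
    rw [h']
    abel
  · refine cotangent_ext fun Z hZ => ?_
    have t1 := courant_courant_snd_apply ha hb hc hab habc hZ x hX hY hW hα hβ hγ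
    have t2 := courant_courant_snd_apply hb hc ha hbc hbca hZ x hY hW hX hβ hγ hα
    have t3 := courant_courant_snd_apply hc ha hb hca hcab hZ x hW hX hY hγ hα hβ
    have j1 := congrArg (γ x) (mlieBracket_jacobi sX sY hZ x)
    have j2 := congrArg (α x) (mlieBracket_jacobi sY sW hZ x)
    have j3 := congrArg (β x) (mlieBracket_jacobi sW sX hZ x)
    rw [map_add] at j1 j2 j3
    -- This is g([a,b],c) = 0, put in cyclic form by α(W) = -γ(X) and β(X) = -α(Y).
    have hcyc : (fun y => dirDeriv W (fun y => α y (Y y)) y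
          + γ y (VectorField.mlieBracket (𝓡 m) X Y y)
          + (dirDeriv X (fun y => β y (W y)) y + α y (VectorField.mlieBracket (𝓡 m) Y W y))
          + (dirDeriv Y (fun y => γ y (X y)) y + β y (VectorField.mlieBracket (𝓡 m) W X y))) =
        fun _ => (0 : ℝ) := by
      funext y
      have e1 : (fun y => α y (W y)) = fun y => -γ y (X y) := by
        funext y
        have := hca y
        rw [g_apply] at this
        subst hW hX hα hγ
        linarith
      have e2 : (fun y => β y (X y)) = fun y => -α y (Y y) := by
        funext y
        have := hab y
        rw [g_apply] at this
        subst hX hY hα hβ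
        linarith
      have h := habc y
      have hs := courant_snd_apply ha hb sW y
      rw [g_apply] at h
      have e3 : (courant a b y).2 (c y).1 = (courant a b y).2 (W y) := by subst hW; rfl
      have e4 : (c y).2 (courant a b y).1 = γ y (VectorField.mlieBracket (𝓡 m) X Y y) := by
        subst hX hY hγ; rfl
      rw [e3, e4, hs, ← hX, ← hY] at h
      have e5 : ∀ y, (a y).2 = α y := fun y => by subst hα; rfl
      have e6 : ∀ y, (b y).2 = β y := fun y => by subst hβ; rfl
      have e7 : ∀ y, (a y).1 = X y := fun y => by subst hX; rfl
      have e8 : ∀ y, (b y).1 = Y y := fun y => by subst hY; rfl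
      simp only [e5, e6, e7, e8] at h
      rw [e1, e2, dirDeriv_neg, dirDeriv_neg,
        VectorField.mlieBracket_swap_apply (V := X) (W := W), map_neg] at h
      linarith
    -- The derivative of `hcyc` along Z: the terms of the cyclic sum that `j1`, `j2`, `j3` do not
    -- cancel.
    have hz : dirDeriv Z (dirDeriv W (fun y => α y (Y y))) x
        + dirDeriv Z (fun y => γ y (VectorField.mlieBracket (𝓡 m) X Y y)) x
        + (dirDeriv Z (dirDeriv X (fun y => β y (W y))) x
          + dirDeriv Z (fun y => α y (VectorField.mlieBracket (𝓡 m) Y W y)) x)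
        + (dirDeriv Z (dirDeriv Y (fun y => γ y (X y))) x
          + dirDeriv Z (fun y => β y (VectorField.mlieBracket (𝓡 m) W X y)) x) = 0 := by
      have h0 : dirDeriv Z (fun _ : M => (0 : ℝ)) x = 0 := by
        simp [dirDeriv, mvfderiv_const]
      rw [← hcyc, dirDeriv_add, dirDeriv_add, dirDeriv_add, dirDeriv_add, dirDeriv_add] at h0
      · exact h0
      all_goals
        repeat' first
          | assumption
          | apply IsSmoothFun.add
          | apply IsSmoothFun.dirDeriv
          | apply IsSmoothOneForm.apply
          | apply IsSmoothVectorField.mlieBracket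
    rw [Prod.snd_add, Prod.snd_add, add_apply, add_apply,
      t1, t2, t3]
    simp only [Prod.snd_zero, zero_apply]
    linarith

end Courant

/-! ### Isotropy of E, skewness of Λ, smooth sections -/

namespace TwoNilpotent

variable (τ : TwoNilpotent m M)

theorem g_map_left (x : M) (v w : BigTangent m x) : g x (τ.map x v) w = -g x v (τ.map x w) := by
  linarith [τ.skew x v w]

/-- g(τv,τw) = -g(v,τ²w). This isotropy is what removes the anomalies of the Courant bracket on E.
-/
theorem g_eq_zero_of_mem {x : M} {v w : BigTangent m x} (hv : v ∈ τ.E x) (hw : w ∈ τ.E x) :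
    g x v w = 0 := by
  obtain ⟨v, rfl⟩ := hv
  obtain ⟨w, rfl⟩ := hw
  rw [g_map_left, τ.map_map, map_zero, neg_zero]

theorem sharp_injective (x : M) : Function.Injective (τ.sharp x) := by
  rw [injective_iff_map_eq_zero]
  intro ξ hξ
  obtain ⟨v, rfl⟩ := τ.toDual_surjective x ξ
  rw [toDual_eq_zero_iff, ← sharp_toDual, hξ]
  rfl

/-- The functionals g(u,·) already separate points, by nondegeneracy of g. -/
theorem eq_of_forall_dual {x : M} {v w : τ.E x} (h : ∀ ξ : τ.Edual x, ξ v = ξ w) : v = w := by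
  refine Subtype.ext (g_injective x (LinearMap.ext fun u => ?_))
  rw [g_comm, g_comm x (w : BigTangent m x)]
  exact h (τ.toDual x u)

theorem dual_map_neg {x : M} (ξ : τ.Edual x) (v : τ.E x) : ξ (-v) = -ξ v := by
  refine eq_neg_of_add_eq_zero_left ?_
  rw [← map_add]
  convert map_zero ξ
  exact Subtype.ext (neg_add_cancel (v : BigTangent m x))

theorem dual_sharp_swap (x : M) (ξ η : τ.Edual x) : η (τ.sharp x ξ) = -ξ (τ.sharp x η) := by
  obtain ⟨v, rfl⟩ := τ.toDual_surjective x ξ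
  obtain ⟨w, rfl⟩ := τ.toDual_surjective x η
  rw [toDual_apply, toDual_apply, sharp_toDual, sharp_toDual, ← g_map_left, g_comm]

theorem bivector_swap (α β : ∀ x, τ.Edual x) (x : M) : τ.bivector α β x = -τ.bivector β α x :=
  τ.dual_sharp_swap x (α x) (β x)

variable {τ}

theorem toDual_mem_secDual {s : ∀ x : M, BigTangent m x} (hs : IsSmoothSection s) :
    (fun x => τ.toDual x (s x)) ∈ τ.secDual := ⟨s, hs, fun _ => rfl⟩

theorem exists_eq_toDual {α : ∀ x, τ.Edual x} (hα : α ∈ τ.secDual) :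
    ∃ s, IsSmoothSection s ∧ α = fun x => τ.toDual x (s x) :=
  let ⟨s, hs, h⟩ := hα
  ⟨s, hs, funext h⟩

theorem sharpSec_toDual_coe (s : ∀ x : M, BigTangent m x) :
    (fun x => (τ.sharpSec (fun y => τ.toDual y (s y)) x : BigTangent m x)) = τ.app s :=
  funext fun x => τ.sharp_toDual x (s x)

theorem sharpSec_mem_secE {α : ∀ x, τ.Edual x} (hα : α ∈ τ.secDual) : τ.sharpSec α ∈ τ.secE := by
  obtain ⟨s, hs, rfl⟩ := exists_eq_toDual hα
  change IsSmoothSection _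
  rw [sharpSec_toDual_coe]
  exact τ.smooth s hs

theorem isSmoothFun_dual_apply {α : ∀ x, τ.Edual x} (hα : α ∈ τ.secDual) {e : ∀ x, τ.E x}
    (he : e ∈ τ.secE) : IsSmoothFun m (fun x => α x (e x)) := by
  obtain ⟨s, hs, rfl⟩ := exists_eq_toDual hα
  exact hs.g he

theorem isSmoothFun_bivector {α β : ∀ x, τ.Edual x} (hα : α ∈ τ.secDual) (hβ : β ∈ τ.secDual) :
    IsSmoothFun m (τ.bivector α β) :=
  isSmoothFun_dual_apply hβ (sharpSec_mem_secE hα)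

theorem isSmoothFun_derivE {e : ∀ x, τ.E x} (he : e ∈ τ.secE) {f : M → ℝ} (hf : IsSmoothFun m f) :
    IsSmoothFun m (τ.derivE e f) := hf.dirDeriv he.1

theorem isSmoothSection_coe {e : ∀ x, τ.E x} (he : e ∈ τ.secE) :
    IsSmoothSection (fun x => (e x : BigTangent m x)) := he

theorem derivE_sub (e : ∀ x, τ.E x) {f h : M → ℝ} (hf : IsSmoothFun m f) (hh : IsSmoothFun m h)
    (x : M) : τ.derivE e (fun y => f y - h y) x = τ.derivE e f x - τ.derivE e h x :=
  dirDeriv_sub _ hf hh x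

theorem dE_eq_toDual (f : M → ℝ) (x : M) : τ.dE f x = τ.toDual x (gradient f x) := by
  refine LinearMap.ext fun v => ?_
  rw [toDual_apply, g_gradient]
  rfl

section Bracket

variable (hτ : τ.IsWeaklyIntegrable)
include hτ

theorem bracketE_coe {e e' : ∀ x, τ.E x} (he : e ∈ τ.secE)
    (he' : e' ∈ τ.secE) (x : M) :
    (τ.bracketE e e' x : BigTangent m x) = courant (fun y => (e y : BigTangent m y))
      (fun y => (e' y : BigTangent m y)) x := by
  rw [bracketE, dif_pos (hτ _ _ he he' (fun y => (e y).2) (fun y => (e' y).2) x)]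

theorem bracketE_swap {e e' : ∀ x, τ.E x} (he : e ∈ τ.secE) (he' : e' ∈ τ.secE) (x : M) :
    τ.bracketE e e' x = -τ.bracketE e' e x := by
  refine Subtype.ext ?_
  rw [Submodule.coe_neg, bracketE_coe hτ he he', bracketE_coe hτ he' he, courant_swap]

theorem anchorE_bracketE {e e' : ∀ x, τ.E x} (he : e ∈ τ.secE) (he' : e' ∈ τ.secE) (x : M) :
    τ.anchorE x (τ.bracketE e e' x) = VectorField.mlieBracket (𝓡 m)
      (fun y => τ.anchorE y (e y)) (fun y => τ.anchorE y (e' y)) x :=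
  congrArg Prod.fst (bracketE_coe hτ he he' x)

/-- This is `dirDeriv_g` with one argument in E: the term with g(e,e') drops by isotropy. It
supplies the covector whose existence `lieDual` asks for. -/
theorem toDual_courant_apply {e e' : ∀ x, τ.E x} (he : e ∈ τ.secE) (he' : e' ∈ τ.secE)
    {t : ∀ x : M, BigTangent m x} (ht : IsSmoothSection t) (x : M) :
    τ.toDual x (courant (fun y => (e y : BigTangent m y)) t x
        + (1 / 2 : ℝ) • gradient (fun y => g y (e y : BigTangent m y) (t y)) x) (e' x) =
      τ.derivE e (fun y => τ.toDual y (t y) (e' y)) x - τ.toDual x (t x) (τ.bracketE e e' x) := by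
  have h := dirDeriv_g he ht he' x
  have h0 : (fun y => g y (e y : BigTangent m y) (e' y)) = fun _ => (0 : ℝ) :=
    funext fun y => τ.g_eq_zero_of_mem (e y).2 (e' y).2
  have h1 : dirDeriv (fun y => (t y).1) (fun _ : M => (0 : ℝ)) x = 0 := by
    simp [dirDeriv, mvfderiv_const]
  rw [h0, h1, ← bracketE_coe hτ he he', g_comm x (τ.bracketE e e' x : BigTangent m x)] at h
  rw [toDual_apply, map_add, map_smul, LinearMap.add_apply, LinearMap.smul_apply, g_gradient,
    toDual_apply, smul_eq_mul]
  have h2 : τ.derivE e (fun y => τ.toDual y (t y) (e' y)) x = _ := h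
  rw [h2]
  simp only [dirDeriv]
  ring

end Bracket

/-! ### Enough smooth sections of E and E* -/

section Sections

variable [T2Space M]

theorem exists_mem_secE {x : M} (v : τ.E x) : ∃ e ∈ τ.secE, e x = v := by
  obtain ⟨_, w, rfl⟩ := v
  obtain ⟨s, hs, rfl⟩ := exists_smooth_section w
  exact ⟨fun y => ⟨τ.map y (s y), s y, rfl⟩, τ.smooth s hs, rfl⟩

theorem dual_ext {x : M} {ξ η : τ.Edual x} (h : ∀ e ∈ τ.secE, ξ (e x) = η (e x)) : ξ = η := by
  refine LinearMap.ext fun v => ?_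
  obtain ⟨e, he, rfl⟩ := exists_mem_secE v
  exact h e he

theorem add_mem_secE {e e' : ∀ x, τ.E x} (he : e ∈ τ.secE) (he' : e' ∈ τ.secE) :
    e + e' ∈ τ.secE := (isSmoothSection_coe he).add (isSmoothSection_coe he')

theorem smul_mem_secE {f : M → ℝ} (hf : IsSmoothFun m f) {e : ∀ x, τ.E x} (he : e ∈ τ.secE) :
    (fun x => f x • e x) ∈ τ.secE := IsSmoothSection.smul hf (isSmoothSection_coe he)

theorem add_mem_secDual {α β : ∀ x, τ.Edual x} (hα : α ∈ τ.secDual) (hβ : β ∈ τ.secDual) :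
    α + β ∈ τ.secDual := by
  obtain ⟨s, hs, rfl⟩ := exists_eq_toDual hα
  obtain ⟨t, ht, rfl⟩ := exists_eq_toDual hβ
  exact ⟨_, hs.add ht, fun x => (map_add _ _ _).symm⟩

theorem smul_mem_secDual {f : M → ℝ} (hf : IsSmoothFun m f) {α : ∀ x, τ.Edual x}
    (hα : α ∈ τ.secDual) : (fun x => f x • α x) ∈ τ.secDual := by
  obtain ⟨s, hs, rfl⟩ := exists_eq_toDual hα
  exact ⟨_, IsSmoothSection.smul hf hs, fun x => (map_smul _ _ _).symm⟩

end Sections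

/-! ### The Lie algebroid E -/

section WeaklyIntegrable

variable [T2Space M] (hτ : τ.IsWeaklyIntegrable)
include hτ

theorem bracketE_mem {e e' : ∀ x, τ.E x} (he : e ∈ τ.secE) (he' : e' ∈ τ.secE) :
    τ.bracketE e e' ∈ τ.secE := by
  change IsSmoothSection _
  rw [funext (bracketE_coe hτ he he')]
  exact IsSmoothSection.courant he he'

/-- All the pairings required to vanish by `courant_jacobi` do so, since E is isotropic and closed
under the bracket. -/
theorem bracketE_jacobi {a b c : ∀ x, τ.E x} (ha : a ∈ τ.secE) (hb : b ∈ τ.secE)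
    (hc : c ∈ τ.secE) (x : M) :
    τ.bracketE (τ.bracketE a b) c x + τ.bracketE (τ.bracketE b c) a x
      + τ.bracketE (τ.bracketE c a) b x = 0 := by
  have key : ∀ {a b c : ∀ x, τ.E x}, a ∈ τ.secE → b ∈ τ.secE → c ∈ τ.secE →
      (τ.bracketE (τ.bracketE a b) c x : BigTangent m x) =
        courant (courant (fun y => (a y : BigTangent m y)) (fun y => (b y : BigTangent m y)))
          (fun y => (c y : BigTangent m y)) x := by
    intro a b c ha hb hc
    rw [bracketE_coe hτ (bracketE_mem hτ ha hb) hc, funext (bracketE_coe hτ ha hb)]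
  have hiso : ∀ (a b : ∀ x, τ.E x) (x : M), g x (a x : BigTangent m x) (b x) = 0 :=
    fun a b x => τ.g_eq_zero_of_mem (a x).2 (b x).2
  have hclosed : ∀ {a b : ∀ x, τ.E x} (c : ∀ x, τ.E x), a ∈ τ.secE → b ∈ τ.secE → ∀ x,
      g x (courant (fun y => (a y : BigTangent m y)) (fun y => (b y : BigTangent m y)) x)
        (c x) = 0 :=
    fun c ha hb x => τ.g_eq_zero_of_mem
      (hτ _ _ ha hb (fun y => (SetLike.coe_mem _)) (fun y => (SetLike.coe_mem _)) x) (c x).2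
  refine Subtype.ext ?_
  rw [Submodule.coe_add, Submodule.coe_add, key ha hb hc, key hb hc ha, key hc ha hb]
  exact courant_jacobi ha hb hc (hiso a b) (hiso b c) (hiso c a) (hclosed c ha hb)
    (hclosed a hb hc) (hclosed b hc ha) x

theorem derivE_bracketE {e e' : ∀ x, τ.E x} (he : e ∈ τ.secE) (he' : e' ∈ τ.secE) {f : M → ℝ}
    (hf : IsSmoothFun m f) (x : M) :
    τ.derivE (τ.bracketE e e') f x = τ.derivE e (τ.derivE e' f) x - τ.derivE e' (τ.derivE e f) x := by
  have h := dirDeriv_mlieBracket he.1 he'.1 hf x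
  rw [derivE, funext (anchorE_bracketE hτ he he')]
  exact h

/-- The bundle `E` with the Courant bracket is a Lie algebroid. -/
theorem isLieAlgebroid_E : IsLieAlgebroid τ.secE τ.bracketE τ.anchorE where
  bracket_mem a ha b hb := bracketE_mem hτ ha hb
  anchor_smooth a ha := ha.1
  add_left a ha b hb c hc := by
    funext x
    refine Subtype.ext ?_
    rw [Pi.add_apply, Submodule.coe_add, bracketE_coe hτ (add_mem_secE ha hb) hc,
      bracketE_coe hτ ha hc, bracketE_coe hτ hb hc]
    exact courant_add_left ha hb hc x
  smul_left r a ha b hb := by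
    funext x
    refine Subtype.ext ?_
    -- Homogeneity comes from the Leibniz formula with a constant function, whose differential is
    -- zero, and skewness.
    have h := courant_smul_right hb ha (isSmoothFun_const r) x
    have hr : r • a ∈ τ.secE := smul_mem_secE (isSmoothFun_const r) ha
    rw [Pi.smul_apply, Submodule.coe_smul, bracketE_coe hτ hr hb, bracketE_coe hτ ha hb,
      courant_swap]
    refine (congrArg Neg.neg h).trans ?_
    rw [courant_swap (fun y => (b y : BigTangent m y))]
    simp [dirDeriv, gradient, mvfderiv_const]
  skew a ha b hb := funext fun x => bracketE_swap hτ ha hb x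
  jacobi a ha b hb c hc := funext fun x => bracketE_jacobi hτ ha hb hc x
  leibniz f hf a ha b hb x := by
    refine Subtype.ext ?_
    have h := courant_smul_right ha hb hf x
    rw [Submodule.coe_add, Submodule.coe_smul, Submodule.coe_smul,
      bracketE_coe hτ ha (smul_mem_secE hf hb), bracketE_coe hτ ha hb]
    refine h.trans ?_
    rw [τ.g_eq_zero_of_mem (a x).2 (b x).2, mul_zero, zero_smul, sub_zero]
    rfl
  anchor_bracket a ha b hb x := anchorE_bracketE hτ ha hb x

/-! ### Calculus on `E` -/

/-- The Dorfman product gives existence, and `dual_ext` uniqueness, so the default value of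
`lieDual` does not occur. -/
theorem lieDual_toDual {e : ∀ x, τ.E x} (he : e ∈ τ.secE) {t : ∀ x : M, BigTangent m x}
    (ht : IsSmoothSection t) (x : M) :
    τ.lieDual e (fun y => τ.toDual y (t y)) x =
      τ.toDual x (courant (fun y => (e y : BigTangent m y)) t x
        + (1 / 2 : ℝ) • gradient (fun y => g y (e y : BigTangent m y) (t y)) x) := by
  have h : ∃ ξ : τ.Edual x, ∀ e' ∈ τ.secE,
      ξ (e' x) = τ.derivE e (fun y => τ.toDual y (t y) (e' y)) x
        - τ.toDual x (t x) (τ.bracketE e e' x) :=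
    ⟨_, fun e' he' => toDual_courant_apply hτ he he' ht x⟩
  rw [lieDual, dif_pos h]
  refine dual_ext fun e' he' => ?_
  rw [h.choose_spec e' he', toDual_courant_apply hτ he he' ht x]

theorem lieDual_mem {e : ∀ x, τ.E x} (he : e ∈ τ.secE) {α : ∀ x, τ.Edual x}
    (hα : α ∈ τ.secDual) : τ.lieDual e α ∈ τ.secDual := by
  obtain ⟨t, ht, rfl⟩ := exists_eq_toDual hα
  exact ⟨_, (IsSmoothSection.courant he ht).add (IsSmoothSection.smul (isSmoothFun_const _)
    (IsSmoothSection.g he ht).gradient), lieDual_toDual hτ he ht⟩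

theorem lieDual_apply {e e' : ∀ x, τ.E x} (he : e ∈ τ.secE) (he' : e' ∈ τ.secE)
    {α : ∀ x, τ.Edual x} (hα : α ∈ τ.secDual) (x : M) :
    τ.lieDual e α x (e' x) = τ.derivE e (fun y => α y (e' y)) x - α x (τ.bracketE e e' x) := by
  obtain ⟨t, ht, rfl⟩ := exists_eq_toDual hα
  rw [lieDual_toDual hτ he ht, toDual_courant_apply hτ he he' ht x]

/-- The dual form of the Jacobi identity of E, together with the fact that the anchor preserves
brackets. -/
theorem lieDual_bracketE {e e' : ∀ x, τ.E x} (he : e ∈ τ.secE) (he' : e' ∈ τ.secE)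
    {α : ∀ x, τ.Edual x} (hα : α ∈ τ.secDual) (x : M) :
    τ.lieDual (τ.bracketE e e') α x =
      τ.lieDual e (τ.lieDual e' α) x - τ.lieDual e' (τ.lieDual e α) x := by
  refine dual_ext fun c hc => ?_
  have h1 := isSmoothFun_dual_apply hα hc
  have h2 : ∀ {a : ∀ x, τ.E x}, a ∈ τ.secE →
      IsSmoothFun m (fun y => α y (τ.bracketE a c y)) :=
    fun ha => isSmoothFun_dual_apply hα (bracketE_mem hτ ha hc)
  have hj := congrArg (α x) (bracketE_jacobi hτ he he' hc x)
  -- Two sign changes, from [c,e] = -[e,c] and from swapping the outer bracket.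
  have h3 : τ.bracketE (τ.bracketE c e) e' x = τ.bracketE e' (τ.bracketE e c) x := by
    have h4 : τ.bracketE c e = (-1 : ℝ) • τ.bracketE e c := by
      funext y
      refine Subtype.ext ?_
      rw [Pi.smul_apply, Submodule.coe_smul, bracketE_coe hτ hc he, bracketE_coe hτ he hc,
        courant_swap, neg_one_smul]
    refine Subtype.ext ?_
    rw [h4, (isLieAlgebroid_E hτ).smul_left _ _ (bracketE_mem hτ he hc) _ he', Pi.smul_apply,
      Submodule.coe_smul, bracketE_coe hτ (bracketE_mem hτ he hc) he',
      bracketE_coe hτ he' (bracketE_mem hτ he hc), courant_swap, neg_one_smul, neg_neg]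
  rw [LinearMap.sub_apply, lieDual_apply hτ (bracketE_mem hτ he he') hc hα,
    lieDual_apply hτ he hc (lieDual_mem hτ he' hα), lieDual_apply hτ he' hc (lieDual_mem hτ he hα),
    lieDual_apply hτ he' (bracketE_mem hτ he hc) hα, lieDual_apply hτ he (bracketE_mem hτ he' hc) hα,
    funext (lieDual_apply hτ he' hc hα), funext (lieDual_apply hτ he hc hα),
    derivE_sub e (isSmoothFun_derivE he' h1) (h2 he'),
    derivE_sub e' (isSmoothFun_derivE he h1) (h2 he), derivE_bracketE hτ he he' h1]
  rw [map_add, map_add, map_zero, bracketE_swap hτ (bracketE_mem hτ he' hc) he,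
    dual_map_neg, h3] at hj
  linarith

theorem gelfandDorfman_apply {α β : ∀ x, τ.Edual x} (hα : α ∈ τ.secDual) (hβ : β ∈ τ.secDual)
    {e : ∀ x, τ.E x} (he : e ∈ τ.secE) (x : M) :
    τ.gelfandDorfman α β x (e x) =
      τ.derivE (τ.sharpSec α) (fun y => β y (e y)) x - β x (τ.bracketE (τ.sharpSec α) e x)
        - (τ.derivE (τ.sharpSec β) (fun y => α y (e y)) x - α x (τ.bracketE (τ.sharpSec β) e x))
        - τ.derivE e (τ.bivector α β) x := by
  rw [gelfandDorfman, LinearMap.sub_apply, LinearMap.sub_apply,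
    lieDual_apply hτ (sharpSec_mem_secE hα) he hβ, lieDual_apply hτ (sharpSec_mem_secE hβ) he hα]
  rfl

/-- L_{♯α}β and -L_{♯β}α each contribute ½ d g(τs,t), because g(τt,s) = -g(τs,t); their sum cancels
d_E(Λ(α,β)). The term -[τt,s] becomes [s,τt]. -/
theorem gelfandDorfman_toDual {s t : ∀ x : M, BigTangent m x} (hs : IsSmoothSection s)
    (ht : IsSmoothSection t) (x : M) :
    τ.gelfandDorfman (fun y => τ.toDual y (s y)) (fun y => τ.toDual y (t y)) x =
      τ.toDual x (courant (τ.app s) t x + courant s (τ.app t) x) := by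
  have h1 : τ.bivector (fun y => τ.toDual y (s y)) (fun y => τ.toDual y (t y)) =
      fun y => g y (τ.app s y) (t y) := funext fun y => τ.bivector_toDual s t y
  have h2 : gradient (m := m) (fun y => g (m := m) y (τ.app t y) (s y)) x =
      -gradient (m := m) (fun y => g (m := m) y (τ.app s y) (t y)) x := by
    have : (fun y => g (m := m) y (τ.app t y) (s y)) = -fun y : M => g y (τ.app s y) (t y) := by
      funext y
      change g y (τ.map y (t y)) (s y) = -g y (τ.map y (s y)) (t y)
      rw [g_map_left, g_comm]
    rw [this]
    simp only [gradient]
    rw [mvfderiv_neg]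
    simp
  rw [gelfandDorfman, lieDual_toDual hτ (sharpSec_mem_secE (toDual_mem_secDual hs)) ht,
    lieDual_toDual hτ (sharpSec_mem_secE (toDual_mem_secDual ht)) hs, sharpSec_toDual_coe,
    sharpSec_toDual_coe, dE_eq_toDual, h1]
  have h3 : ∀ r : ∀ x : M, BigTangent m x, ∀ y,
      (τ.sharpSec (fun y => τ.toDual y (r y)) y : BigTangent m y) = τ.app r y :=
    fun r => congrFun (sharpSec_toDual_coe r)
  simp only [h3]
  rw [h2, courant_swap s, ← map_sub, ← map_sub]
  congr 1
  rw [← sub_eq_zero]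
  module

theorem gelfandDorfman_mem {α β : ∀ x, τ.Edual x} (hα : α ∈ τ.secDual) (hβ : β ∈ τ.secDual) :
    τ.gelfandDorfman α β ∈ τ.secDual := by
  obtain ⟨s, hs, rfl⟩ := exists_eq_toDual hα
  obtain ⟨t, ht, rfl⟩ := exists_eq_toDual hβ
  exact ⟨_, ((τ.smooth s hs).courant ht).add (hs.courant (τ.smooth t ht)),
    gelfandDorfman_toDual hτ hs ht⟩

/-! ### Integrability -/

/-- Since τ² = 0, the torsion of s, t is [τs,τt] - τ([τs,t] + [s,τt]), which is [♯α,♯β] - ♯{α,β} for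
the classes α, β of s, t. -/
theorem isIntegrable_iff_sharp_bracket : τ.IsIntegrable ↔
    ∀ α ∈ τ.secDual, ∀ β ∈ τ.secDual, ∀ x,
      τ.sharp x (τ.gelfandDorfman α β x) = τ.bracketE (τ.sharpSec α) (τ.sharpSec β) x := by
  have key : ∀ {s t : ∀ x : M, BigTangent m x}, IsSmoothSection s → IsSmoothSection t → ∀ x,
      τ.nijenhuis s t x = 0 ↔
        τ.sharp x (τ.gelfandDorfman (fun y => τ.toDual y (s y)) (fun y => τ.toDual y (t y)) x) =
          τ.bracketE (τ.sharpSec fun y => τ.toDual y (s y))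
            (τ.sharpSec fun y => τ.toDual y (t y)) x := by
    intro s t hs ht x
    rw [gelfandDorfman_toDual hτ hs ht, Subtype.ext_iff, sharp_toDual,
      bracketE_coe hτ (sharpSec_mem_secE (toDual_mem_secDual hs))
        (sharpSec_mem_secE (toDual_mem_secDual ht)), sharpSec_toDual_coe, sharpSec_toDual_coe,
      nijenhuis, τ.map_map, add_zero, map_add, sub_sub, sub_eq_zero, add_comm, eq_comm]
  constructor
  · intro h α hα β hβ x
    obtain ⟨s, hs, rfl⟩ := exists_eq_toDual hα
    obtain ⟨t, ht, rfl⟩ := exists_eq_toDual hβ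
    exact (key hs ht x).1 (h s t hs ht x)
  · intro h s t hs ht x
    exact (key hs ht x).2 (h _ (toDual_mem_secDual hs) _ (toDual_mem_secDual ht) x)

/-- The bracket identities become, after the injective map ♯, those of E; the anchor is compatible
because it factors through ♯. -/
theorem isLieAlgebroid_dual (h : ∀ α ∈ τ.secDual, ∀ β ∈ τ.secDual, ∀ x,
      τ.sharp x (τ.gelfandDorfman α β x) = τ.bracketE (τ.sharpSec α) (τ.sharpSec β) x) :
    IsLieAlgebroid τ.secDual τ.gelfandDorfman τ.anchorDual := by
  have hE := isLieAlgebroid_E hτ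
  have hsec : ∀ {α β : ∀ x, τ.Edual x}, α ∈ τ.secDual → β ∈ τ.secDual →
      τ.sharpSec (τ.gelfandDorfman α β) = τ.bracketE (τ.sharpSec α) (τ.sharpSec β) :=
    fun hα hβ => funext (h _ hα _ hβ)
  have hadd : ∀ α β : ∀ x, τ.Edual x, τ.sharpSec (α + β) = τ.sharpSec α + τ.sharpSec β :=
    fun α β => funext fun x => map_add (τ.sharp x) (α x) (β x)
  have hsmul : ∀ (f : M → ℝ) (α : ∀ x, τ.Edual x),
      τ.sharpSec (fun y => f y • α y) = fun y => f y • τ.sharpSec α y :=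
    fun f α => funext fun x => map_smul (τ.sharp x) (f x) (α x)
  have hs : ∀ {α : ∀ x, τ.Edual x}, α ∈ τ.secDual → τ.sharpSec α ∈ τ.secE := sharpSec_mem_secE
  have hgd : ∀ {α β : ∀ x, τ.Edual x}, α ∈ τ.secDual → β ∈ τ.secDual →
      τ.gelfandDorfman α β ∈ τ.secDual := gelfandDorfman_mem hτ
  exact {
    bracket_mem := fun a ha b hb => hgd ha hb
    anchor_smooth := fun a ha => (hs ha).1
    add_left := by
      intro a ha b hb c hc
      funext x
      apply τ.sharp_injective x
      rw [h _ (add_mem_secDual ha hb) _ hc, hadd, hE.add_left _ (hs ha) _ (hs hb) _ (hs hc),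
        Pi.add_apply, Pi.add_apply, map_add, h _ ha _ hc, h _ hb _ hc]
    smul_left := by
      intro r a ha b hb
      funext x
      apply τ.sharp_injective x
      have hr : r • a ∈ τ.secDual := smul_mem_secDual (isSmoothFun_const r) ha
      have hr' : τ.sharpSec (r • a) = r • τ.sharpSec a := hsmul (fun _ => r) a
      rw [h _ hr _ hb, hr', hE.smul_left r _ (hs ha) _ (hs hb), Pi.smul_apply, Pi.smul_apply,
        map_smul, h _ ha _ hb]
    skew := by
      intro a ha b hb
      funext x
      apply τ.sharp_injective x
      rw [Pi.neg_apply, map_neg, h _ ha _ hb, h _ hb _ ha, hE.skew _ (hs ha) _ (hs hb),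
        Pi.neg_apply]
    jacobi := by
      intro a ha b hb c hc
      funext x
      apply τ.sharp_injective x
      rw [Pi.add_apply, Pi.add_apply, map_add, map_add, h _ (hgd ha hb) _ hc,
        h _ (hgd hb hc) _ ha, h _ (hgd hc ha) _ hb, hsec ha hb, hsec hb hc, hsec hc ha,
        bracketE_jacobi hτ (hs ha) (hs hb) (hs hc), Pi.zero_apply, map_zero]
    leibniz := by
      intro f hf a ha b hb x
      apply τ.sharp_injective x
      rw [h _ ha _ (smul_mem_secDual hf hb), hsmul, hE.leibniz f hf _ (hs ha) _ (hs hb), map_add,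
        map_smul, map_smul, h _ ha _ hb]
      rfl
    anchor_bracket := by
      intro a ha b hb x
      have h1 : τ.anchorDual x (τ.gelfandDorfman a b x) =
          τ.anchorE x (τ.sharp x (τ.gelfandDorfman a b x)) := rfl
      rw [h1, h _ ha _ hb]
      exact anchorE_bracketE hτ (hs ha) (hs hb) x }

/-- Evaluate {α,β} on ♯γ and move ♯ across by the skewness of Λ: the derivatives of Λ and the
remaining brackets are exactly those of the cyclic sum. -/
theorem schoutenSquare_eq {α β γ : ∀ x, τ.Edual x} (hα : α ∈ τ.secDual) (hβ : β ∈ τ.secDual)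
    (hγ : γ ∈ τ.secDual) (x : M) :
    τ.schoutenSquare α β γ x =
      2 * (γ x (τ.bracketE (τ.sharpSec α) (τ.sharpSec β) x)
        - γ x (τ.sharp x (τ.gelfandDorfman α β x))) := by
  have h := gelfandDorfman_apply hτ hα hβ (sharpSec_mem_secE hγ) x
  have h1 : τ.derivE (τ.sharpSec α) (fun y => β y (τ.sharpSec γ y)) x =
      -τ.derivE (τ.sharpSec α) (τ.bivector β γ) x := by
    rw [show (fun y => β y (τ.sharpSec γ y)) = fun y => -τ.bivector β γ y from
      funext (τ.bivector_swap γ β)]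
    exact dirDeriv_neg _ x
  have h2 : (fun y => α y (τ.sharpSec γ y)) = τ.bivector γ α := rfl
  rw [h1, h2, bracketE_swap hτ (sharpSec_mem_secE hα) (sharpSec_mem_secE hγ),
    dual_map_neg] at h
  rw [τ.dual_sharp_swap x (τ.gelfandDorfman α β x)]
  change τ.gelfandDorfman α β x (τ.sharp x (γ x)) = _ at h
  rw [h, schoutenSquare]
  ring

theorem sharp_bracket_of_schouten (h : ∀ α ∈ τ.secDual, ∀ β ∈ τ.secDual, ∀ γ ∈ τ.secDual, ∀ x,
      τ.schoutenSquare α β γ x = 0) :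
    ∀ α ∈ τ.secDual, ∀ β ∈ τ.secDual, ∀ x,
      τ.sharp x (τ.gelfandDorfman α β x) = τ.bracketE (τ.sharpSec α) (τ.sharpSec β) x := by
  intro α hα β hβ x
  refine τ.eq_of_forall_dual fun φ => ?_
  obtain ⟨v, rfl⟩ := τ.toDual_surjective x φ
  obtain ⟨s, hs, rfl⟩ := exists_smooth_section v
  have h1 := h α hα β hβ _ (toDual_mem_secDual hs) x
  rw [schoutenSquare_eq hτ hα hβ (toDual_mem_secDual hs)] at h1
  linarith

/-- `d_* e = -L_e Λ`. -/
theorem dStar_eq_neg_lieBivector {e : ∀ x, τ.E x} (he : e ∈ τ.secE) {α β : ∀ x, τ.Edual x}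
    (hα : α ∈ τ.secDual) (hβ : β ∈ τ.secDual) (x : M) :
    τ.dStar e α β x = -τ.lieBivector e τ.bivector α β x := by
  have h := gelfandDorfman_apply hτ hα hβ he x
  -- Λ(L_eα, β) = -(L_eα)(♯β), expanded by the definition of L_e.
  have h1 : τ.bivector (τ.lieDual e α) β x =
      τ.derivE e (τ.bivector α β) x + α x (τ.bracketE e (τ.sharpSec β) x) := by
    rw [bivector_swap, bivector, lieDual_apply hτ he (sharpSec_mem_secE hβ) hα,
      show (fun y => α y (τ.sharpSec β y)) = fun y => -τ.bivector α β y from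
        funext (τ.bivector_swap β α)]
    have : τ.derivE e (fun y => -τ.bivector α β y) x = -τ.derivE e (τ.bivector α β) x :=
      dirDeriv_neg _ x
    rw [this]
    ring
  have h2 : τ.bivector α (τ.lieDual e β) x =
      τ.derivE e (τ.bivector α β) x - β x (τ.bracketE e (τ.sharpSec α) x) :=
    lieDual_apply hτ he (sharpSec_mem_secE hα) hβ x
  rw [bracketE_swap hτ (sharpSec_mem_secE hα) he, bracketE_swap hτ (sharpSec_mem_secE hβ) he,
    dual_map_neg, dual_map_neg] at h
  rw [lieBivector, h1, h2, dStar, h]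
  simp only [derivE, anchorDual, sharpSec, LinearMap.comp_apply]
  ring

/-- With d_*e = -L_eΛ, the claim is that L_[e,e'] is the commutator of L_e and L_e' on Λ, which
follows from the same rule on functions and on sections of E*. -/
theorem dStar_bracketE {e e' : ∀ x, τ.E x} (he : e ∈ τ.secE) (he' : e' ∈ τ.secE)
    {α β : ∀ x, τ.Edual x} (hα : α ∈ τ.secDual) (hβ : β ∈ τ.secDual) (x : M) :
    τ.dStar (τ.bracketE e e') α β x =
      τ.lieBivector e (τ.dStar e') α β x - τ.lieBivector e' (τ.dStar e) α β x := by
  have hsub : ∀ {f h k : M → ℝ} (c : ∀ x, τ.E x), IsSmoothFun m f → IsSmoothFun m h →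
      IsSmoothFun m k → τ.derivE c (fun y => -(f y - h y - k y)) x =
        -(τ.derivE c f x - τ.derivE c h x - τ.derivE c k x) := by
    intro f h k c hf hh hk
    rw [← derivE_sub c hf hh, ← derivE_sub c (hf.sub hh) hk]
    exact dirDeriv_neg _ x
  -- This is -L_a L_b Λ. The terms with one Lie derivative on each argument, and those
  -- differentiating Λ of a Lie derivative, are symmetric in a and b, so they drop out of the
  -- difference.
  have exp : ∀ {a b : ∀ x, τ.E x}, a ∈ τ.secE → b ∈ τ.secE →
      τ.lieBivector a (τ.dStar b) α β x =
        -(τ.derivE a (τ.derivE b (τ.bivector α β)) x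
          - τ.derivE a (τ.bivector (τ.lieDual b α) β) x
          - τ.derivE a (τ.bivector α (τ.lieDual b β)) x)
        + (τ.derivE b (τ.bivector (τ.lieDual a α) β) x
          - τ.bivector (τ.lieDual b (τ.lieDual a α)) β x
          - τ.bivector (τ.lieDual a α) (τ.lieDual b β) x)
        + (τ.derivE b (τ.bivector α (τ.lieDual a β)) x
          - τ.bivector (τ.lieDual b α) (τ.lieDual a β) x
          - τ.bivector α (τ.lieDual b (τ.lieDual a β)) x) := by
    intro a b ha hb
    have l := fun {c : ∀ x, τ.E x} (hc : c ∈ τ.secE) {γ : ∀ x, τ.Edual x} (hγ : γ ∈ τ.secDual) =>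
      lieDual_mem hτ hc hγ
    rw [lieBivector, funext (dStar_eq_neg_lieBivector hτ hb hα hβ),
      dStar_eq_neg_lieBivector hτ hb (l ha hα) hβ, dStar_eq_neg_lieBivector hτ hb hα (l ha hβ)]
    simp only [lieBivector]
    rw [hsub a (isSmoothFun_derivE hb (isSmoothFun_bivector hα hβ))
      (isSmoothFun_bivector (l hb hα) hβ) (isSmoothFun_bivector hα (l hb hβ))]
    ring
  rw [exp he he', exp he' he, dStar_eq_neg_lieBivector hτ (bracketE_mem hτ he he') hα hβ,
    lieBivector, derivE_bracketE hτ he he' (isSmoothFun_bivector hα hβ)]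
  have b1 : τ.bivector (τ.lieDual (τ.bracketE e e') α) β x =
      τ.bivector (τ.lieDual e (τ.lieDual e' α)) β x
        - τ.bivector (τ.lieDual e' (τ.lieDual e α)) β x := by
    simp only [bivector, sharpSec]
    rw [lieDual_bracketE hτ he he' hα, map_sub, map_sub]
  have b2 : τ.bivector α (τ.lieDual (τ.bracketE e e') β) x =
      τ.bivector α (τ.lieDual e (τ.lieDual e' β)) x
        - τ.bivector α (τ.lieDual e' (τ.lieDual e β)) x := by
    simp only [bivector]
    rw [lieDual_bracketE hτ he he' hβ, LinearMap.sub_apply]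
  rw [b1, b2]
  ring

end WeaklyIntegrable

end TwoNilpotent

end GenGeom

end

theorem proposition4p3 (m : ℕ) (M : Type*) [TopologicalSpace M] [T2Space M]
    [SecondCountableTopology M] [ChartedSpace (EuclideanSpace ℝ (Fin m)) M]
    [IsManifold (𝓡 m) ∞ M] (τ : GenGeom.TwoNilpotent m M) (hτ : τ.IsWeaklyIntegrable) :
    (τ.IsIntegrable ↔ τ.IsDualLieAlgebroid) ∧
      (τ.IsIntegrable ↔ τ.IsTriangularLieBialgebroid) := by
  open GenGeom GenGeom.TwoNilpotent in
  -- Both equivalences are now with ♯{α,β} = [♯α,♯β]; the converse directions use only the anchor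
  -- condition in the first and [Λ,Λ] = 0 in the second.
  rw [isIntegrable_iff_sharp_bracket hτ]
  refine ⟨⟨fun h => ⟨isLieAlgebroid_dual hτ h, h⟩, fun h => h.sharp_bracket⟩,
    ⟨fun h => ⟨isLieAlgebroid_E hτ, isLieAlgebroid_dual hτ h,
      fun e he e' he' α hα β hβ x => dStar_bracketE hτ he he' hα hβ x,
      fun α hα β hβ γ hγ x => ?_⟩, fun h => sharp_bracket_of_schouten hτ h.schouten⟩⟩
  rw [schoutenSquare_eq hτ hα hβ hγ, h α hα β hβ, sub_self, mul_zero]
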